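/- A \emph{tribe} is a category $\mathcal C$ with a subcategory of \emph{fibrations} such that (i) $\mathcal C$ has a terminal object $1$ and every $X\to 1$ is a fibration; (ii) pullbacks along fibrations exist and fibrations are stable under pullback; (iii) every map factors as an \emph{anodyne} map (one with the left lifting property against all fibrations) followed by a fibration; (iv) anodyne maps are stable under pullback along fibrations. A \emph{path object} of $X$ is a factorisation $X\to P_X\xrightarrow{(\partial_0,\partial_1)}X\times X$ of the diagonal into an anodyne map and a fibration; maps $f,g:A\to X$ are \emph{homotopic} if $f=\partial_0h$, $g=\partial_1h$ for some $h:A\to P_X$ into a path object, and \emph{homotopy equivalences} are the maps having an inverse up to homotopy. A commutative square is a \emph{homotopy pullback} if, after one of the two maps into its final corner is factored as an anodyne map followed by a fibration, the comparison map to the resulting strict pullback is a homotopy equivalence; $f:X\to Y$ is a \emph{homotopy monomorphism} (is homotopy monic) if the square with sides $\mathrm{id}_X,\mathrm{id}_X,f,f$ is a homotopy pullback. The \emph{fibrant slice} $\mathcal C/\!\!/S$ is the full subcategory of $\mathcal C/S$ on the fibrations, with the maps whose underlying map is a fibration as its fibrations; it is again a tribe. A \emph{$\pi$-tribe} is a tribe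 in which, for every fibration $p:X\to Y$, the functor $p^*:\mathcal C/Y\to\mathcal C/X$ has a partial right adjoint $\Pi_p:\mathcal C/\!\!/X\to\mathcal C/\!\!/Y$ that preserves homotopy equivalences. In a $\pi$-tribe, let $A,B\in\mathcal C/\!\!/S$ have path objects $P_A,P_B$ in $\mathcal C/\!\!/S$, and let $\mathsf{Hom}$ denote the internal hom and $\times$ the product over $S$. Let $\mathsf{RInv}(A,B)$ be the pullback of $(\partial_{0*},\partial_{1*}):\mathsf{Hom}(B,P_B)\to\mathsf{Hom}(B,B)^2$ along $(c,\mathrm{const}_{\mathrm{id}_B}):\mathsf{Hom}(A,B)\times\mathsf{Hom}(B,A)\to\mathsf{Hom}(B,B)^2$, where $c$ is internal composition, let $\mathsf{LInv}(A,B)$ be the pullback of $\mathsf{Hom}(A,P_A)\to\mathsf{Hom}(A,A)^2$ along $(c,\mathrm{const}_{\mathrm{id}_A}):\mathsf{Hom}(B,A)\times\mathsf{Hom}(A,B)\to\mathsf{Hom}(A,A)^2$, and let $\mathsf{Eq}_S(A,B)=\mathsf{RInv}(A,B)\times_{\mathsf{Hom}(A,B)}\mathsf{LInv}(A,B)$.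 A fibration $p:E\to B$ is \emph{univalent} if the map $\delta_E:B\to\mathsf{Eq}_{B\times B}(\pi_1^*p,\pi_2^*p)$ over $B\times B$, given over the diagonal by $\mathrm{id}_E$ with $\mathrm{id}_E$ as left and right inverse and with constant homotopies, is a homotopy equivalence (this does not depend on the choices made). Let $S_p$ be the class of all pullbacks of $p$; it is a \emph{local class}, i.e. a class of fibrations closed under pullback. A \emph{homotopy subobject classifier} for a local class $S$ is a univalent homotopy monic fibration $\top$ such that every homotopy monic fibration in $S$ is a strict pullback of $\top$. \textbf{Theorem.} Let $p:E\to B$ be a univalent fibration in a $\pi$-tribe $\mathcal C$. Let $E\to P_p\xrightarrow{(\partial_0,\partial_1)}E\times_BE$ be a path object of $p$ in $\mathcal C/\!\!/B$, let $p\times p:E\times_BE\to B$ be the product of $p$ with itself in $\mathcal C/\!\!/B$, let $\Omega_p=\Pi_{p\times p}(P_p)\to B$, and let $\top:\mathsf{El}(\Omega_p)\to\Omega_p$ be the pullback of $p$ along $\Omega_p\to B$. Then $\top$ is a homotopy subobject classifier for $S_p$: it is a univalent homotopy monic fibration, and every homotopy monic fibration in $S_p$ is a strict pullback of $\top$. 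-/

import Mathlib

open CategoryTheory Limits Opposite

universe v u

namespace Tribes

/-! ### Tribes -/

section Basic

variable {C : Type u} [Category.{v} C]

/-- A category `C` with a class `F` of fibrations is a tribe.  The anodyne maps are the maps with the
left lifting property with respect to all fibrations, that is the class `F.llp`. -/
class IsTribe (F : MorphismProperty C) : Prop extends
    F.IsMultiplicative, F.IsStableUnderBaseChange where
  hasTerminal : HasTerminal C
  fibrant : ∀ (X : C), F (terminal.from X)
  hasPullback : ∀ {X Y Z : C} (f : X ⟶ Z) (p : Y ⟶ Z), F p → HasPullback f p
  factor : ∀ {X Y : C} (f : X ⟶ Y),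
    ∃ (Z : C) (i : X ⟶ Z) (p : Z ⟶ Y), F.llp i ∧ F p ∧ i ≫ p = f
  anodyne_pullback : ∀ {A' A B' B : C} {q : A' ⟶ A} {i' : A' ⟶ B'} {i : A ⟶ B} {p : B' ⟶ B},
    IsPullback q i' i p → F p → F.llp i → F.llp i'

/-- A path object for `X`: a factorisation `X ⟶ obj ⟶ X × X` of the diagonal into an anodyne map
followed by a fibration, for some binary product `sq` of `X` with itself. -/
structure PathObject (F : MorphismProperty C) (X : C) where
  /-- the product `X × X` -/
  sq : C
  π₁ : sq ⟶ X
  π₂ : sq ⟶ X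
  isLimit : IsLimit (BinaryFan.mk π₁ π₂)
  obj : C
  /-- the anodyne map `X ⟶ obj` -/
  i : X ⟶ obj
  /-- the fibration `(∂₀, ∂₁) : obj ⟶ X × X` -/
  d : obj ⟶ sq
  anodyne_i : F.llp i
  fib_d : F d
  i_d_π₁ : i ≫ d ≫ π₁ = 𝟙 X
  i_d_π₂ : i ≫ d ≫ π₂ = 𝟙 X

namespace PathObject

variable {F : MorphismProperty C} {X : C} (P : PathObject F X)

/-- the first endpoint `∂₀` -/
def d₀ : P.obj ⟶ X := P.d ≫ P.π₁

/-- the second endpoint `∂₁` -/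
def d₁ : P.obj ⟶ X := P.d ≫ P.π₂

lemma i_d₀ : P.i ≫ P.d₀ = 𝟙 X := P.i_d_π₁

lemma i_d₁ : P.i ≫ P.d₁ = 𝟙 X := P.i_d_π₂

end PathObject

/-- `f` and `g` are homotopic: there is a map into a path object of the target with endpoints
`f` and `g`. -/
def Homotopic (F : MorphismProperty C) {A X : C} (f g : A ⟶ X) : Prop :=
  ∃ (P : PathObject F X) (h : A ⟶ P.obj), h ≫ P.d₀ = f ∧ h ≫ P.d₁ = g

/-- `f` is a homotopy equivalence. -/
def IsHomotopyEquiv (F : MorphismProperty C) {A B : C} (f : A ⟶ B) : Prop :=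
  ∃ g : B ⟶ A, Homotopic F (f ≫ g) (𝟙 A) ∧ Homotopic F (g ≫ f) (𝟙 B)

/-- A commutative square is a homotopy pullback: for some (equivalently, every) factorisation
`Z ⟶ Z' ⟶ B` of `g` into an anodyne map and a fibration, the comparison map from the corner `W`
to the strict pullback of `Z' ⟶ B` along `f` is a homotopy equivalence. -/
def IsHomotopyPullback (F : MorphismProperty C) {W Y Z B : C}
    (fst : W ⟶ Y) (snd : W ⟶ Z) (f : Y ⟶ B) (g : Z ⟶ B) : Prop :=
  fst ≫ f = snd ≫ g ∧
    ∃ (Z' : C) (i : Z ⟶ Z') (q : Z' ⟶ B), F.llp i ∧ F q ∧ i ≫ q = g ∧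
      ∃ (Q : C) (a : Q ⟶ Y) (b : Q ⟶ Z') (k : W ⟶ Q), IsPullback a b f q ∧
        k ≫ a = fst ∧ k ≫ b = snd ≫ i ∧ IsHomotopyEquiv F k

/-- `f : X ⟶ Y` is a homotopy monomorphism: the square with two sides `𝟙 X` and two sides `f`
is a homotopy pullback. -/
def IsHomotopyMono (F : MorphismProperty C) {X Y : C} (f : X ⟶ Y) : Prop :=
  IsHomotopyPullback F (𝟙 X) (𝟙 X) f f

/-! ### Fibrant slices -/

/-- The fibrant slice `C // S`: the full subcategory of `C / S` spanned by the fibrations. -/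
abbrev FibrantSlice (F : MorphismProperty C) (S : C) : Type (max u v) :=
  (F.overObj (X := S)).FullSubcategory

/-- A fibration `p : E ⟶ S` as an object of the fibrant slice over `S`. -/
abbrev FibrantSlice.of {F : MorphismProperty C} {E S : C} (p : E ⟶ S) (hp : F p) :
    FibrantSlice F S :=
  ⟨Over.mk p, hp⟩

lemma FibrantSlice.fib {F : MorphismProperty C} {S : C} (A : FibrantSlice F S) : F A.obj.hom :=
  A.property

/-- The fibrations of the fibrant slice: the maps whose underlying map in `C` is a fibration. -/
def sliceFib (F : MorphismProperty C) (S : C) : MorphismProperty (FibrantSlice F S) :=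
  fun _ _ u => F u.hom.left

variable {F : MorphismProperty C}

lemma IsTribe.hasPullbacksAlong [IsTribe F] {X Y : C} {p : X ⟶ Y} (hp : F p) :
    HasPullbacksAlong p :=
  fun h => IsTribe.hasPullback h p hp

instance [IsTribe F] {S : C} (A : FibrantSlice F S) : HasPullbacksAlong A.obj.hom :=
  IsTribe.hasPullbacksAlong A.fib

instance [IsTribe F] {S X : C} (f : X ⟶ S) (A : FibrantSlice F S) : HasPullback f A.obj.hom :=
  IsTribe.hasPullback f _ A.fib

/-- The pullback `f^* A` of a fibration `A` over `S` along an arbitrary map `f : X ⟶ S`. -/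
noncomputable def baseChange [IsTribe F] {S X : C} (f : X ⟶ S) (A : FibrantSlice F S) :
    FibrantSlice F X :=
  FibrantSlice.of (pullback.fst f A.obj.hom)
    (MorphismProperty.pullback_fst f A.obj.hom A.fib)

/-! ### Dependent products and π-tribes -/

/-- A dependent product `Π_A Z` of a fibration `Z` over `A` along the fibration `A` over `Y`: a
fibration over `Y` together with bijections `Hom_{C / Y}(f, Π_A Z) ≃ Hom_{C / A}(A^* f, Z)`, natural
in all objects `f` of the full slice `C / Y`. -/
structure DependentProduct [IsTribe F] {Y : C} (A : FibrantSlice F Y)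
    (Z : FibrantSlice F A.obj.left) where
  obj : FibrantSlice F Y
  repr : ((Over.pullback A.obj.hom).op ⋙ yoneda.obj Z.obj).RepresentableBy obj.obj

/-- The functorial action of dependent products on maps. -/
noncomputable def DependentProduct.map [IsTribe F] {Y : C} {A : FibrantSlice F Y} {Z Z' : FibrantSlice F A.obj.left}
    (W : DependentProduct A Z) (W' : DependentProduct A Z') (g : Z ⟶ Z') : W.obj ⟶ W'.obj :=
  ObjectProperty.homMk (W'.repr.homEquiv.symm
    ((W.repr.homEquiv (𝟙 W.obj.obj) : (Over.pullback A.obj.hom).obj W.obj.obj ⟶ Z.obj) ≫ g.hom))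

/-- A tribe is a π-tribe if pullback along any fibration has a partial right adjoint, defined between
the fibrant slices, which preserves homotopy equivalences. -/
class IsPiTribe (F : MorphismProperty C) : Prop extends IsTribe F where
  exists_dependentProduct : ∀ {Y : C} (A : FibrantSlice F Y) (Z : FibrantSlice F A.obj.left),
    Nonempty (DependentProduct A Z)
  map_isHomotopyEquiv : ∀ {Y : C} {A : FibrantSlice F Y} {Z Z' : FibrantSlice F A.obj.left}
    (W : DependentProduct A Z) (W' : DependentProduct A Z') (g : Z ⟶ Z'),
    IsHomotopyEquiv (sliceFib F A.obj.left) g → IsHomotopyEquiv (sliceFib F Y) (W.map W' g)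

/-! ### Products and internal homs in a slice -/

section Slice

variable [IsTribe F] {S : C}

/-- The functor `- × A` on the slice `C / S`, for a fibration `A` over `S`. -/
noncomputable abbrev prodFunctor (A : FibrantSlice F S) : Over S ⥤ Over S :=
  Over.pullback A.obj.hom ⋙ Over.map A.obj.hom

/-- The product `X × A` in `C / S`. -/
noncomputable abbrev prodObj (X : Over S) (A : FibrantSlice F S) : Over S := (prodFunctor A).obj X

/-- The projection `X × A ⟶ X`. -/
noncomputable def pfst (X : Over S) (A : FibrantSlice F S) : prodObj X A ⟶ X :=
  Over.homMk (pullback.fst X.hom A.obj.hom) pullback.condition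

/-- The projection `X × A ⟶ A`. -/
noncomputable def psnd (X : Over S) (A : FibrantSlice F S) : prodObj X A ⟶ A.obj :=
  Over.homMk (pullback.snd X.hom A.obj.hom) rfl

/-- The pairing `(f, g) : Y ⟶ X × A`. -/
noncomputable def plift {X Y : Over S} {A : FibrantSlice F S} (f : Y ⟶ X) (g : Y ⟶ A.obj) :
    Y ⟶ prodObj X A :=
  Over.homMk (pullback.lift f.left g.left ((Over.w f).trans (Over.w g).symm))
    ((pullback.lift_snd_assoc _ _ _ _).trans (Over.w g))

lemma plift_pfst {X Y : Over S} {A : FibrantSlice F S} (f : Y ⟶ X) (g : Y ⟶ A.obj) :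
    plift f g ≫ pfst X A = f := by
  ext; exact pullback.lift_fst _ _ _

lemma plift_psnd {X Y : Over S} {A : FibrantSlice F S} (f : Y ⟶ X) (g : Y ⟶ A.obj) :
    plift f g ≫ psnd X A = g := by
  ext; exact pullback.lift_snd _ _ _

lemma prod_hom_ext {X Y : Over S} {A : FibrantSlice F S} {f g : Y ⟶ prodObj X A}
    (h₁ : f ≫ pfst X A = g ≫ pfst X A) (h₂ : f ≫ psnd X A = g ≫ psnd X A) : f = g := by
  ext
  apply pullback.hom_ext
  · exact congrArg CommaMorphism.left h₁
  · exact congrArg CommaMorphism.left h₂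

lemma map_pfst {X X' : Over S} (A : FibrantSlice F S) (x : X ⟶ X') :
    (prodFunctor A).map x ≫ pfst X' A = pfst X A ≫ x := by
  ext; exact pullback.lift_fst _ _ _

lemma map_psnd {X X' : Over S} (A : FibrantSlice F S) (x : X ⟶ X') :
    (prodFunctor A).map x ≫ psnd X' A = psnd X A := by
  ext; exact pullback.lift_snd _ _ _

/-- An internal hom `Hom_S(A, Z)` of fibrations over `S`: a fibration over `S` which represents
`X ↦ Hom_{C / S}(X × A, Z)` on the full slice `C / S`. -/
structure InternalHom (A Z : FibrantSlice F S) where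
  obj : FibrantSlice F S
  repr : ((prodFunctor A).op ⋙ yoneda.obj Z.obj).RepresentableBy obj.obj

namespace InternalHom

variable {A Z : FibrantSlice F S} (H : InternalHom A Z)

/-- Adjoint transposition `Hom(X, Hom(A, Z)) → Hom(X × A, Z)`. -/
noncomputable def uncurry {X : Over S} (t : X ⟶ H.obj.obj) : prodObj X A ⟶ Z.obj := H.repr.homEquiv t

/-- Adjoint transposition `Hom(X × A, Z) → Hom(X, Hom(A, Z))`. -/
noncomputable def curry {X : Over S} (t : prodObj X A ⟶ Z.obj) : X ⟶ H.obj.obj := H.repr.homEquiv.symm t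

lemma uncurry_curry {X : Over S} (t : prodObj X A ⟶ Z.obj) : H.uncurry (H.curry t) = t :=
  H.repr.homEquiv.apply_symm_apply t

lemma uncurry_comp {X X' : Over S} (x : X ⟶ X') (t : X' ⟶ H.obj.obj) :
    H.uncurry (x ≫ t) = (prodFunctor A).map x ≫ H.uncurry t :=
  H.repr.homEquiv_comp x t

lemma comp_curry {X X' : Over S} (x : X ⟶ X') (t : prodObj X' A ⟶ Z.obj) :
    x ≫ H.curry t = H.curry ((prodFunctor A).map x ≫ t) :=
  H.repr.comp_homEquiv_symm (X := X) (X' := X') t x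

/-- Postcomposition `u_* : Hom(A, Z) ⟶ Hom(A, Z')` with a map `u : Z ⟶ Z'`. -/
noncomputable def post {Z' : FibrantSlice F S} (H' : InternalHom A Z') (u : Z ⟶ Z') : H.obj.obj ⟶ H'.obj.obj :=
  H'.curry (H.uncurry (𝟙 _) ≫ u.hom)

lemma curry_post {Z' : FibrantSlice F S} (H' : InternalHom A Z') (u : Z ⟶ Z') {X : Over S}
    (t : prodObj X A ⟶ Z.obj) : H.curry t ≫ H.post H' u = H'.curry (t ≫ u.hom) := by
  rw [post, comp_curry, ← Category.assoc, ← uncurry_comp, Category.comp_id, uncurry_curry]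

end InternalHom

/-- The composite over `X` of maps `X × A ⟶ X × B` and `X × B ⟶ X × D` over `X`, which are given by
their second components `f` and `g`. -/
noncomputable def compOver {X : Over S} {A B D : FibrantSlice F S}
    (g : prodObj X B ⟶ D.obj) (f : prodObj X A ⟶ B.obj) : prodObj X A ⟶ D.obj :=
  plift (pfst X A) f ≫ g

lemma map_compOver {X X' : Over S} {A B D : FibrantSlice F S} (x : X ⟶ X')
    (g : prodObj X' B ⟶ D.obj) (f : prodObj X' A ⟶ B.obj) :
    (prodFunctor A).map x ≫ compOver g f =
      compOver ((prodFunctor B).map x ≫ g) ((prodFunctor A).map x ≫ f) := by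
  simp only [compOver, ← Category.assoc]
  congr 1
  apply prod_hom_ext
  · simp only [Category.assoc, plift_pfst, map_pfst]
    rw [← Category.assoc, plift_pfst]
  · simp only [Category.assoc, plift_psnd, map_psnd]

/-- The internal composition map `Hom(B, D) × Hom(A, B) ⟶ Hom(A, D)`. -/
noncomputable def internalComp {A B D : FibrantSlice F S} (HBD : InternalHom B D)
    (HAB : InternalHom A B) (HAD : InternalHom A D) :
    prodObj HBD.obj.obj HAB.obj ⟶ HAD.obj.obj :=
  HAD.curry (compOver (HBD.uncurry (pfst _ _)) (HAB.uncurry (psnd _ _)))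

/-- The constant map `X ⟶ 1 ⟶ Hom(A, A)` at the identity of `A`: the transpose of the projection
`X × A ⟶ A`. -/
noncomputable def constId {A : FibrantSlice F S} (HAA : InternalHom A A) (X : Over S) :
    X ⟶ HAA.obj.obj :=
  HAA.curry (psnd X A)

/-! ### Objects of equivalences -/

/-- The map `(c_{A,B,A}, const_A) : Hom(B, A) × Hom(A, B) ⟶ Hom(A, A) × Hom(A, A)`. -/
noncomputable def compConst {A B : FibrantSlice F S} (HBA : InternalHom B A)
    (HAB : InternalHom A B) (HAA : InternalHom A A) :
    prodObj HBA.obj.obj HAB.obj ⟶ prodObj HAA.obj.obj HAA.obj :=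
  plift (internalComp HBA HAB HAA) (constId HAA _)

/-- The map `(∂₀_*, ∂₁_*) : Hom(A, P_A) ⟶ Hom(A, A) × Hom(A, A)`. -/
noncomputable def pathEnds {A : FibrantSlice F S} (P : PathObject (sliceFib F S) A)
    (HAP : InternalHom A P.obj) (HAA : InternalHom A A) :
    HAP.obj.obj ⟶ prodObj HAA.obj.obj HAA.obj :=
  plift (HAP.post HAA P.d₀) (HAP.post HAA P.d₁)

/-- The construction of an object of equivalences `Eq_S(A, B)` of two fibrations over `S`, from
path objects of `A` and `B` in the fibrant slice over `S`: choices of the internal homs and of the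
pullbacks `RInv(A, B)`, `LInv(A, B)` and `Eq(A, B) = RInv(A, B) ×_{Hom(A, B)} LInv(A, B)`. -/
structure ObjectOfEquivalences {A B : FibrantSlice F S} (PA : PathObject (sliceFib F S) A)
    (PB : PathObject (sliceFib F S) B) where
  HAB : InternalHom A B
  HBA : InternalHom B A
  HAA : InternalHom A A
  HBB : InternalHom B B
  HAPA : InternalHom A PA.obj
  HBPB : InternalHom B PB.obj
  RInv : Over S
  rTop : RInv ⟶ HBPB.obj.obj
  rProj : RInv ⟶ prodObj HAB.obj.obj HBA.obj
  rInv_isPullback : IsPullback rTop rProj (pathEnds PB HBPB HBB) (compConst HAB HBA HBB)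
  LInv : Over S
  lTop : LInv ⟶ HAPA.obj.obj
  lProj : LInv ⟶ prodObj HBA.obj.obj HAB.obj
  lInv_isPullback : IsPullback lTop lProj (pathEnds PA HAPA HAA) (compConst HBA HAB HAA)
  obj : Over S
  toRInv : obj ⟶ RInv
  toLInv : obj ⟶ LInv
  isPullback : IsPullback toRInv toLInv (rProj ≫ pfst _ _) (lProj ≫ psnd _ _)

lemma curry_pathEnds {A : FibrantSlice F S} (P : PathObject (sliceFib F S) A)
    (HAP : InternalHom A P.obj) (HAA : InternalHom A A) {X : Over S}
    (t : prodObj X A ⟶ P.obj.obj) :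
    HAP.curry t ≫ pathEnds P HAP HAA =
      plift (HAA.curry (t ≫ P.d₀.hom)) (HAA.curry (t ≫ P.d₁.hom)) := by
  apply prod_hom_ext
  · rw [Category.assoc, pathEnds, plift_pfst, plift_pfst, InternalHom.curry_post]
  · rw [Category.assoc, pathEnds, plift_psnd, plift_psnd, InternalHom.curry_post]

lemma plift_compConst {A B : FibrantSlice F S} (HBA : InternalHom B A)
    (HAB : InternalHom A B) (HAA : InternalHom A A) {X : Over S}
    (g : prodObj X B ⟶ A.obj) (e : prodObj X A ⟶ B.obj) :
    plift (HBA.curry g) (HAB.curry e) ≫ compConst HBA HAB HAA =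
      plift (HAA.curry (compOver g e)) (HAA.curry (psnd X A)) := by
  apply prod_hom_ext
  · rw [Category.assoc, compConst, plift_pfst, plift_pfst, internalComp, InternalHom.comp_curry,
      map_compOver, ← InternalHom.uncurry_comp, ← InternalHom.uncurry_comp, plift_pfst, plift_psnd,
      InternalHom.uncurry_curry, InternalHom.uncurry_curry]
  · rw [Category.assoc, compConst, plift_psnd, plift_psnd, constId, InternalHom.comp_curry,
      map_psnd]

/-- The map `X ⟶ Eq_S(A, B)` over `S` given by a map `e : X × A ⟶ X × B` over `X`, a left homotopy
inverse `g`, a right homotopy inverse `h` and homotopies `H : g e ∼ id` and `K : e h ∼ id`, all of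
them over `X`. -/
noncomputable def ObjectOfEquivalences.lift {A B : FibrantSlice F S}
    {PA : PathObject (sliceFib F S) A} {PB : PathObject (sliceFib F S) B}
    (O : ObjectOfEquivalences PA PB) {X : Over S}
    (e : prodObj X A ⟶ B.obj) (g h : prodObj X B ⟶ A.obj)
    (H : prodObj X A ⟶ PA.obj.obj) (K : prodObj X B ⟶ PB.obj.obj)
    (H₀ : H ≫ PA.d₀.hom = compOver g e) (H₁ : H ≫ PA.d₁.hom = psnd X A)
    (K₀ : K ≫ PB.d₀.hom = compOver e h) (K₁ : K ≫ PB.d₁.hom = psnd X B) : X ⟶ O.obj :=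
  O.isPullback.lift
    (O.rInv_isPullback.lift (O.HBPB.curry K) (plift (O.HAB.curry e) (O.HBA.curry h))
      (by rw [curry_pathEnds, plift_compConst, K₀, K₁]))
    (O.lInv_isPullback.lift (O.HAPA.curry H) (plift (O.HBA.curry g) (O.HAB.curry e))
      (by rw [curry_pathEnds, plift_compConst, H₀, H₁]))
    (by rw [← Category.assoc, ← Category.assoc, IsPullback.lift_snd, IsPullback.lift_snd,
      plift_pfst, plift_psnd])

end Slice

/-! ### Univalent fibrations -/

lemma IsTribe.hasBinaryProduct (F : MorphismProperty C) [IsTribe F] (X Y : C) :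
    HasBinaryProduct X Y := by
  have := IsTribe.hasTerminal (F := F)
  have := IsTribe.hasPullback (terminal.from X) (terminal.from Y) (IsTribe.fibrant (F := F) Y)
  exact ⟨⟨⟨_, isProductOfIsTerminalIsPullback _ _ _ _ terminalIsTerminal
    (pullbackIsPullback (terminal.from X) (terminal.from Y))⟩⟩⟩

section Univalence

variable [IsTribe F] {B S : C}

lemma idOver_aux (E : FibrantSlice F B) (π₁ π₂ : S ⟶ B) (s : B ⟶ S)
    (h₁ : s ≫ π₁ = 𝟙 B) (h₂ : s ≫ π₂ = 𝟙 B) :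
    (pullback.fst s (pullback.fst π₁ E.obj.hom) ≫ s) ≫ π₂ =
      (pullback.snd s (pullback.fst π₁ E.obj.hom) ≫ pullback.snd π₁ E.obj.hom) ≫ E.obj.hom := by
  have h := pullback.condition (f := s) (g := pullback.fst π₁ E.obj.hom)
  have h' := pullback.condition (f := π₁) (g := E.obj.hom)
  rw [Category.assoc, h₂, Category.assoc, ← h', ← Category.assoc, ← h, Category.assoc, h₁]

/-- For maps `π₁ π₂ : S ⟶ B` with a common section `s` and a fibration `E` over `B`, the identity
of `E = s^* π₁^* E = s^* π₂^* E`, as a map `s × π₁^* E ⟶ π₂^* E` in the slice over `S`. -/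
noncomputable def idOver (E : FibrantSlice F B) (π₁ π₂ : S ⟶ B) (s : B ⟶ S)
    (h₁ : s ≫ π₁ = 𝟙 B) (h₂ : s ≫ π₂ = 𝟙 B) :
    prodObj (Over.mk s) (baseChange π₁ E) ⟶ (baseChange π₂ E).obj :=
  Over.homMk
    (pullback.lift (pullback.fst s (pullback.fst π₁ E.obj.hom) ≫ s)
      (pullback.snd s (pullback.fst π₁ E.obj.hom) ≫ pullback.snd π₁ E.obj.hom)
      (idOver_aux E π₁ π₂ s h₁ h₂))
    ((pullback.lift_fst _ _ _).trans pullback.condition)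

lemma compOver_idOver (E : FibrantSlice F B) (π₁ π₂ : S ⟶ B) (s : B ⟶ S)
    (h₁ : s ≫ π₁ = 𝟙 B) (h₂ : s ≫ π₂ = 𝟙 B) :
    compOver (idOver E π₂ π₁ s h₂ h₁) (idOver E π₁ π₂ s h₁ h₂) =
      psnd (Over.mk s) (baseChange π₁ E) := by
  ext
  apply pullback.hom_ext
  · refine Eq.trans (Category.assoc _ _ _) ?_
    refine (congrArg (_ ≫ ·) (pullback.lift_fst _ _ _)).trans ?_
    exact (pullback.lift_fst_assoc _ _ _ _).trans pullback.condition
  · refine Eq.trans (Category.assoc _ _ _) ?_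
    refine (congrArg (_ ≫ ·) (pullback.lift_snd _ _ _)).trans ?_
    exact (pullback.lift_snd_assoc _ _ _ _).trans (pullback.lift_snd _ _ _)

/-- The canonical map `δ_E : B ⟶ Eq_{S}(π₁^* E, π₂^* E)` over `S`, for `S` with two maps
`π₁ π₂ : S ⟶ B` and a common section `s` (in the application, `S = B × B` and `s` is the diagonal).
It is given by the identity of `E`, with the identity as left and right inverse and with constant
homotopies. -/
noncomputable def delta (E : FibrantSlice F B) (π₁ π₂ : S ⟶ B) (s : B ⟶ S)
    (h₁ : s ≫ π₁ = 𝟙 B) (h₂ : s ≫ π₂ = 𝟙 B)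
    {P₁ : PathObject (sliceFib F S) (baseChange π₁ E)}
    {P₂ : PathObject (sliceFib F S) (baseChange π₂ E)} (O : ObjectOfEquivalences P₁ P₂) :
    Over.mk s ⟶ O.obj :=
  O.lift (idOver E π₁ π₂ s h₁ h₂) (idOver E π₂ π₁ s h₂ h₁) (idOver E π₂ π₁ s h₂ h₁)
    (psnd _ _ ≫ P₁.i.hom) (psnd _ _ ≫ P₂.i.hom)
    (by
      rw [compOver_idOver, Category.assoc, ← ObjectProperty.FullSubcategory.comp_hom, P₁.i_d₀]
      exact Category.comp_id _)
    (by
      rw [Category.assoc, ← ObjectProperty.FullSubcategory.comp_hom, P₁.i_d₁]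
      exact Category.comp_id _)
    (by
      rw [compOver_idOver, Category.assoc, ← ObjectProperty.FullSubcategory.comp_hom, P₂.i_d₀]
      exact Category.comp_id _)
    (by
      rw [Category.assoc, ← ObjectProperty.FullSubcategory.comp_hom, P₂.i_d₁]
      exact Category.comp_id _)

end Univalence

/-- A fibration `p : E ⟶ B` is univalent if `δ_E : B ⟶ Eq_{B × B}(π₁^* p, π₂^* p)` is a homotopy
equivalence, for some choice (equivalently, for every choice) of the path objects, internal homs and
pullbacks that enter the construction of the object of equivalences. -/
def IsUnivalent (F : MorphismProperty C) [IsPiTribe F] {E B : C} (p : E ⟶ B) : Prop :=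
  haveI := IsTribe.hasBinaryProduct F B B
  ∃ (hp : F p)
    (P₁ : PathObject (sliceFib F (B ⨯ B)) (baseChange prod.fst (FibrantSlice.of p hp)))
    (P₂ : PathObject (sliceFib F (B ⨯ B)) (baseChange prod.snd (FibrantSlice.of p hp)))
    (O : ObjectOfEquivalences P₁ P₂),
    IsHomotopyEquiv F
      (delta (FibrantSlice.of p hp) prod.fst prod.snd (diag B)
        (prod.lift_fst _ _) (prod.lift_snd _ _) O).left

/-! ### Homotopy subobject classifiers -/

/-- A local class: a class of fibrations closed under pullback. -/
structure LocalClass (F : MorphismProperty C) where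
  mem : MorphismProperty C
  le_fib : mem ≤ F
  stable : mem.IsStableUnderBaseChange

/-- The local class `S_p` of all morphisms obtained as pullbacks of the fibration `p`. -/
def pullbackClass [IsTribe F] {E B : C} (p : E ⟶ B) (hp : F p) : LocalClass F where
  mem X Y f := ∃ (q : X ⟶ E) (χ : Y ⟶ B), IsPullback q f p χ
  le_fib := by
    rintro X Y f ⟨q, χ, h⟩
    exact MorphismProperty.of_isPullback h hp
  stable := ⟨by
    rintro X Y Y' S f g f' g' h ⟨q, χ, hq⟩
    exact ⟨_, _, h.paste_horiz hq⟩⟩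

/-- A homotopy subobject classifier for a local class `S`: a univalent homotopy monic fibration of
which every homotopy monic fibration in `S` is a strict pullback. -/
structure IsHomotopySubobjectClassifier (F : MorphismProperty C) [IsPiTribe F] (S : LocalClass F)
    {El Ω : C} (top : El ⟶ Ω) : Prop where
  fib : F top
  mono : IsHomotopyMono F top
  univalent : IsUnivalent F top
  classifies : ∀ {A X : C} (f : A ⟶ X), S.mem f → IsHomotopyMono F f →
    ∃ (a : A ⟶ El) (χ : X ⟶ Ω), IsPullback a f top χ

end Basic

end Tribes

namespace Tribes

/-! ### Homotopies over a base -/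

section Relative

variable {C : Type u} [Category.{v} C] {F : MorphismProperty C}

/-! Write `π : Ω ⟶ B` for the structure map of the dependent product. By its universal property,
lifting `χ : X ⟶ B` through `π` is the same as giving a section of the path fibration of `χ^* p`.
Such a section joins any two points of a common fibre by a path, so it exists exactly when `χ^* p`
is homotopy monic. One direction contracts pairs of points along paths
(`isHomotopyMono_of_section`). In the other, the homotopy monomorphism gives a section up to
homotopy, which homotopy lifting along the path fibration makes strict
(`IsHomotopyMono.exists_section`). The identity of `Ω` then shows that `top` is homotopy monic. A
homotopy monic `χ^* p` yields a lift of `χ` to `Ω`, and cancelling pullback squares exhibits it as a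
strict pullback of `top`.

Univalence of `top` rests on `π` having propositional fibres (`DependentProduct.homotopicOver`):
after base change along `π` the path fibration has a section, so it is fibrewise contractible
(`homotopicOver_d_section`). Since dependent products preserve homotopy equivalences, `Ω ×_B Ω ⟶ Ω`
is contractible too, and any two maps to `Ω` with the same composite to `B` are homotopic over `B`.

Univalence descends along such a `π` (`IsUnivalent.of_isPullback`). Path objects, internal homs and
dependent products commute with base change, so the object of equivalences of `top` can be taken to
be the pullback of that of `p` along `π × π`, with `δ` for `top` lying over `δ` for `p`. The
homotopy contracting the latter onto `B` lifts, and the remaining discrepancy is absorbed because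
the fibres of `π × π` are propositional.

Homotopies are handled through `HomotopicOver`, which does not fix a path object. For fibrations it
agrees with `Homotopic` in the fibrant slice (`homotopic_sliceFib_iff`), and over the terminal
object with `Homotopic` in the tribe (`homotopic_iff`). -/

lemma exists_lift_of_llp {A B X Y : C} {i : A ⟶ B} {p : X ⟶ Y} (hi : F.llp i) (hp : F p)
    (f : A ⟶ X) (g : B ⟶ Y) (w : f ≫ p = i ≫ g) : ∃ l : B ⟶ X, i ≫ l = f ∧ l ≫ p = g := by
  have := hi p hp
  have sq : CommSq f i p g := ⟨w⟩
  exact ⟨sq.lift, sq.fac_left, sq.fac_right⟩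

/-- The maps `g, h : T ⟶ X` are homotopic over `Y`, where `X` is an object over `Y` by `f`: they are
the restrictions of two maps `Z ⟶ X` over `Y` which agree on the source of an anodyne map to `Z`. -/
def HomotopicOver (F : MorphismProperty C) {X Y T : C} (f : X ⟶ Y) (g h : T ⟶ X) : Prop :=
  ∃ (W Z : C) (i : W ⟶ Z) (d₀ d₁ : Z ⟶ X) (t : T ⟶ Z),
    F.llp i ∧ i ≫ d₀ = i ≫ d₁ ∧ d₀ ≫ f = d₁ ≫ f ∧ t ≫ d₀ = g ∧ t ≫ d₁ = h

/-- A path object of `f : X ⟶ Y` in the slice over `Y`. -/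
structure RelativePathObject (F : MorphismProperty C) {X Y : C} (f : X ⟶ Y) where
  sq : C
  π₁ : sq ⟶ X
  π₂ : sq ⟶ X
  isPullback : IsPullback π₁ π₂ f f
  obj : C
  i : X ⟶ obj
  d : obj ⟶ sq
  anodyne_i : F.llp i
  fib_d : F d
  i_d₀ : i ≫ d ≫ π₁ = 𝟙 X
  i_d₁ : i ≫ d ≫ π₂ = 𝟙 X

namespace HomotopicOver

variable {X Y T : C} {f : X ⟶ Y}

lemma of_agree {W Z : C} {i : W ⟶ Z} (hi : F.llp i) {d₀ d₁ : Z ⟶ X} (h : i ≫ d₀ = i ≫ d₁)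
    (hf : d₀ ≫ f = d₁ ≫ f) : HomotopicOver F f d₀ d₁ :=
  ⟨W, Z, i, d₀, d₁, 𝟙 _, hi, h, hf, Category.id_comp _, Category.id_comp _⟩

lemma refl (f : X ⟶ Y) (g : T ⟶ X) : HomotopicOver F f g g :=
  of_agree (MorphismProperty.llp_of_isIso F (𝟙 T)) rfl rfl

lemma of_eq {g h : T ⟶ X} (e : g = h) : HomotopicOver F f g h := e ▸ refl f g

lemma symm {g h : T ⟶ X} : HomotopicOver F f g h → HomotopicOver F f h g := by
  rintro ⟨W, Z, i, d₀, d₁, t, hi, h₁, h₂, h₃, h₄⟩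
  exact ⟨W, Z, i, d₁, d₀, t, hi, h₁.symm, h₂.symm, h₄, h₃⟩

lemma precomp {g h : T ⟶ X} (H : HomotopicOver F f g h) {T' : C} (t' : T' ⟶ T) :
    HomotopicOver F f (t' ≫ g) (t' ≫ h) := by
  obtain ⟨W, Z, i, d₀, d₁, t, hi, h₁, h₂, rfl, rfl⟩ := H
  exact ⟨W, Z, i, d₀, d₁, t' ≫ t, hi, h₁, h₂, Category.assoc _ _ _, Category.assoc _ _ _⟩

/-- Since the definition fixes no path object, `u` need not be extended to a map of path objects: it
is simply composed with both ends. -/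
lemma postcomp {g h : T ⟶ X} (H : HomotopicOver F f g h) {X' Y' : C} (f' : X' ⟶ Y') (u : X ⟶ X')
    (y : Y ⟶ Y') (w : u ≫ f' = f ≫ y) : HomotopicOver F f' (g ≫ u) (h ≫ u) := by
  obtain ⟨W, Z, i, d₀, d₁, t, hi, h₁, h₂, rfl, rfl⟩ := H
  refine ⟨W, Z, i, d₀ ≫ u, d₁ ≫ u, t, hi, ?_, ?_, ?_, ?_⟩
  · rw [reassoc_of% h₁]
  · rw [Category.assoc, Category.assoc, w, reassoc_of% h₂]
  · rw [Category.assoc]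
  · rw [Category.assoc]

/-- A homotopy over `Y` lifts to every path object. -/
lemma exists_lift {g h : T ⟶ X} (H : HomotopicOver F f g h) (P : RelativePathObject F f) :
    ∃ t : T ⟶ P.obj, t ≫ P.d ≫ P.π₁ = g ∧ t ≫ P.d ≫ P.π₂ = h := by
  obtain ⟨W, Z, i, d₀, d₁, t, hi, h₁, h₂, rfl, rfl⟩ := H
  obtain ⟨l, -, hl⟩ := exists_lift_of_llp hi P.fib_d (i ≫ d₀ ≫ P.i) (P.isPullback.lift d₀ d₁ h₂) (by
    apply P.isPullback.hom_ext
    · simp only [Category.assoc, P.i_d₀, IsPullback.lift_fst, Category.comp_id]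
    · simp only [Category.assoc, P.i_d₁, IsPullback.lift_snd, Category.comp_id, h₁])
  refine ⟨t ≫ l, ?_, ?_⟩
  · rw [Category.assoc, reassoc_of% hl, IsPullback.lift_fst]
  · rw [Category.assoc, reassoc_of% hl, IsPullback.lift_snd]

end HomotopicOver

variable [IsTribe F]

/-- The pullback of a section of `b`, along a map `a`, is anodyne if the section is anodyne and `a` is
a fibration. -/
lemma anodyne_of_pullback_section {N P Q Z : C} {fst : N ⟶ P} {snd : N ⟶ Z} {a : P ⟶ Q} {b : Z ⟶ Q}
    (h : IsPullback fst snd a b) (ha : F a) {s : Q ⟶ Z} (hs : s ≫ b = 𝟙 Q) (hi : F.llp s)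
    {j : P ⟶ N} (h₁ : j ≫ fst = 𝟙 P) (h₂ : j ≫ snd = a ≫ s) : F.llp j := by
  have hsnd : F snd := MorphismProperty.of_isPullback h ha
  refine IsTribe.anodyne_pullback (q := a) (i := s) (p := snd) ?_ hsnd hi
  -- Stacking the square of `j` and `s` on the given pullback yields a square whose vertical sides
  -- are identities. Hence `j` is the base change of `s` along the fibration `snd`.
  have : IsPullback a (j ≫ fst) (s ≫ b) a := by
    rw [h₁, hs]; exact IsPullback.of_vert_isIso ⟨by simp⟩
  exact IsPullback.of_bot this h₂.symm h.flip

lemma RelativePathObject.nonempty {X Y : C} {f : X ⟶ Y} (hf : F f) :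
    Nonempty (RelativePathObject F f) := by
  have := IsTribe.hasPullback f f hf
  obtain ⟨Z, i, d, hi, hd, w⟩ := IsTribe.factor (F := F) (pullback.lift (𝟙 X) (𝟙 X) rfl : X ⟶ pullback f f)
  exact ⟨⟨_, _, _, IsPullback.of_hasPullback f f, Z, i, d, hi, hd,
    by rw [reassoc_of% w, pullback.lift_fst], by rw [reassoc_of% w, pullback.lift_snd]⟩⟩

lemma RelativePathObject.fib_d₀ {X Y : C} {f : X ⟶ Y} (P : RelativePathObject F f) (hf : F f) :
    F (P.d ≫ P.π₁) :=
  F.comp_mem _ _ P.fib_d (MorphismProperty.of_isPullback P.isPullback.flip hf)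

lemma RelativePathObject.fib_d₁ {X Y : C} {f : X ⟶ Y} (P : RelativePathObject F f) (hf : F f) :
    F (P.d ≫ P.π₂) :=
  F.comp_mem _ _ P.fib_d (MorphismProperty.of_isPullback P.isPullback hf)

lemma HomotopicOver.trans {X Y T : C} {f : X ⟶ Y} (hf : F f) {g h k : T ⟶ X}
    (H : HomotopicOver F f g h) (K : HomotopicOver F f h k) : HomotopicOver F f g k := by
  obtain ⟨P⟩ := RelativePathObject.nonempty (F := F) hf
  obtain ⟨s, rfl, hs⟩ := H.exists_lift P
  obtain ⟨t, ht, rfl⟩ := K.exists_lift P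
  have := IsTribe.hasPullback (P.d ≫ P.π₂) (P.d ≫ P.π₁) (P.fib_d₀ hf)
  have w : P.d ≫ P.π₁ ≫ f = P.d ≫ P.π₂ ≫ f := by rw [P.isPullback.w]
  have hc := pullback.condition (f := P.d ≫ P.π₂) (g := P.d ≫ P.π₁)
  -- The pullback consists of composable pairs of paths, and appending a constant path is anodyne.
  -- The two outer endpoints thus agree on an anodyne copy of `X`, so no concatenated path has to be
  -- constructed.
  have hj : F.llp (pullback.lift (𝟙 _) ((P.d ≫ P.π₂) ≫ P.i)
      (by simp only [Category.assoc, P.i_d₀, Category.id_comp, Category.comp_id]) :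
        P.obj ⟶ pullback (P.d ≫ P.π₂) (P.d ≫ P.π₁)) :=
    anodyne_of_pullback_section (IsPullback.of_hasPullback _ _) (P.fib_d₁ hf) P.i_d₀ P.anodyne_i
      (pullback.lift_fst _ _ _) (pullback.lift_snd _ _ _)
  refine ⟨X, _, P.i ≫ _, pullback.fst _ _ ≫ P.d ≫ P.π₁, pullback.snd _ _ ≫ P.d ≫ P.π₂,
    pullback.lift s t (hs.trans ht.symm), MorphismProperty.comp_mem _ _ _ P.anodyne_i hj, ?_, ?_, ?_, ?_⟩
  · rw [Category.assoc, pullback.lift_fst_assoc, Category.assoc, pullback.lift_snd_assoc,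
      Category.id_comp, P.i_d₀, Category.assoc, P.i_d₁, Category.comp_id, P.i_d₁]
  · simp only [Category.assoc] at hc ⊢
    rw [w, reassoc_of% hc, w]
  · rw [pullback.lift_fst_assoc]
  · rw [pullback.lift_snd_assoc]

/-- Homotopy lifting along a fibration. -/
lemma HomotopicOver.lift_fibration {P Q Y T : C} {d : P ⟶ Q} (hd : F d) {f : Q ⟶ Y} (hf : F f)
    {c c' : T ⟶ Q} (H : HomotopicOver F f c c') (l : T ⟶ P) (hl : l ≫ d = c) :
    ∃ l' : T ⟶ P, l' ≫ d = c' ∧ HomotopicOver F (d ≫ f) l l' := by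
  obtain ⟨R⟩ := RelativePathObject.nonempty (F := F) hf
  obtain ⟨t, h₀, h₁⟩ := H.exists_lift R
  have := IsTribe.hasPullback d (R.d ≫ R.π₁) (R.fib_d₀ hf)
  -- The pullback consists of points of `P` with a path in `Q` starting at their image. Pairing a
  -- point with the constant path is anodyne, so the lift `r` against `d` transports points along
  -- paths, and it agrees with the projection on constant paths.
  have hj : F.llp (pullback.lift (𝟙 _) (d ≫ R.i)
      (by simp only [Category.assoc, R.i_d₀, Category.id_comp, Category.comp_id]) :
        P ⟶ pullback d (R.d ≫ R.π₁)) :=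
    anodyne_of_pullback_section (IsPullback.of_hasPullback _ _) hd R.i_d₀ R.anodyne_i
      (pullback.lift_fst _ _ _) (pullback.lift_snd _ _ _)
  obtain ⟨r, hr, hr'⟩ := exists_lift_of_llp hj hd (𝟙 _) (pullback.snd _ _ ≫ R.d ≫ R.π₂) (by
    rw [pullback.lift_snd_assoc, Category.assoc, R.i_d₁, Category.id_comp, Category.comp_id])
  refine ⟨pullback.lift l t (hl.trans h₀.symm) ≫ r, ?_, ?_⟩
  · rw [Category.assoc, hr', pullback.lift_snd_assoc, h₁]
  · refine ⟨_, _, _, pullback.fst _ _, r, pullback.lift l t (hl.trans h₀.symm), hj, ?_, ?_, ?_, rfl⟩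
    · rw [hr, pullback.lift_fst]
    · rw [reassoc_of% hr', pullback.condition_assoc]
      simp only [Category.assoc, R.isPullback.w]
    · rw [pullback.lift_fst]

/-- A fibration `d` with a section `s` such that `s` is a homotopy inverse of `d` is a homotopy
equivalence over its target. -/
lemma homotopicOver_section {P A Y : C} {d : P ⟶ A} {f : A ⟶ Y} (hd : F d) (hf : F f) {s : A ⟶ P}
    (hs : s ≫ d = 𝟙 A) (H : HomotopicOver F (d ≫ f) (d ≫ s) (𝟙 P)) :
    HomotopicOver F d (d ≫ s) (𝟙 P) := by
  -- The given homotopy goes from `d ≫ s`, which lifts through `r` as `d ≫ j`, to the identity; so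
  -- `r` acquires a section `τ`. On `Z` the maps `r ≫ d ≫ s` and `r` agree after `j` and have the
  -- same composite with `d`. Restricting them along `τ` gives a homotopy over `A`.
  obtain ⟨Z, j, r, hj, hr, w⟩ := IsTribe.factor (F := F) s
  obtain ⟨τ, hτ, -⟩ := H.lift_fibration hr (F.comp_mem _ _ hd hf) (d ≫ j) (by rw [Category.assoc, w])
  refine ⟨A, Z, j, r ≫ d ≫ s, r, τ, hj, ?_, ?_, ?_, hτ⟩
  · rw [reassoc_of% w, w, reassoc_of% hs]
  · rw [Category.assoc, Category.assoc, hs, Category.comp_id]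
  · rw [reassoc_of% hτ]

/-- Anodyne maps between fibrations over `B` are stable under base change along every map. -/
lemma anodyne_baseChange {X Z B D X' Z' : C} {i : X ⟶ Z} {x : X ⟶ B} {z : Z ⟶ B} {c : D ⟶ B}
    {ξ : X' ⟶ X} {x' : X' ⟶ D} {ζ : Z' ⟶ Z} {z' : Z' ⟶ D} {i' : X' ⟶ Z'}
    (hi : F.llp i) (hx : F x) (hz : F z) (w : i ≫ z = x)
    (hX : IsPullback ξ x' x c) (hZ : IsPullback ζ z' z c)
    (h₁ : i' ≫ ζ = ξ ≫ i) (h₂ : i' ≫ z' = x') : F.llp i' := by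
  -- Base change along the fibration `c'` is axiom (iv) and gives `k`. Base change along `j` is not
  -- covered by it, but the projections `a` and `b` of total spaces are anodyne, being pullbacks of
  -- `j` along fibrations.
  obtain ⟨D', j, c', hj, hc', rfl⟩ := IsTribe.factor (F := F) c
  have := IsTribe.hasPullback x c' hc'
  have := IsTribe.hasPullback z c' hc'
  obtain ⟨k, hk₁, hk₂⟩ : ∃ k : pullback x c' ⟶ pullback z c',
      k ≫ pullback.fst _ _ = pullback.fst _ _ ≫ i ∧ k ≫ pullback.snd _ _ = pullback.snd _ _ :=
    ⟨pullback.lift (pullback.fst _ _ ≫ i) (pullback.snd _ _)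
      (by rw [Category.assoc, w, pullback.condition]), pullback.lift_fst _ _ _, pullback.lift_snd _ _ _⟩
  have hk : F.llp k := by
    refine IsTribe.anodyne_pullback (q := pullback.fst _ _) (i := i) (p := pullback.fst _ _) ?_
      (MorphismProperty.pullback_fst _ _ hc') hi
    refine (IsPullback.of_right (h₁₂ := pullback.snd z c') (h₂₂ := z) (v₁₃ := c') (h₁₁ := k)
      (v₁₁ := pullback.fst x c') ?_ hk₁
      (IsPullback.of_hasPullback z c').flip).flip
    rw [w, hk₂]
    exact (IsPullback.of_hasPullback x c').flip
  obtain ⟨a, a₁, a₂⟩ : ∃ a : X' ⟶ pullback x c',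
      a ≫ pullback.fst _ _ = ξ ∧ a ≫ pullback.snd _ _ = x' ≫ j :=
    ⟨pullback.lift ξ (x' ≫ j) (by rw [hX.w, Category.assoc]), pullback.lift_fst _ _ _,
      pullback.lift_snd _ _ _⟩
  obtain ⟨b, b₁, b₂⟩ : ∃ b : Z' ⟶ pullback z c',
      b ≫ pullback.fst _ _ = ζ ∧ b ≫ pullback.snd _ _ = z' ≫ j :=
    ⟨pullback.lift ζ (z' ≫ j) (by rw [hZ.w, Category.assoc]), pullback.lift_fst _ _ _,
      pullback.lift_snd _ _ _⟩
  have ha : F.llp a := by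
    refine IsTribe.anodyne_pullback (q := x') (i := j) (p := pullback.snd x c') ?_
      (MorphismProperty.pullback_snd _ _ hx) hj
    refine (IsPullback.of_right (h₁₂ := pullback.fst x c') (h₂₂ := c') (v₁₃ := x) (h₁₁ := a)
      (v₁₁ := x') ?_ a₂ (IsPullback.of_hasPullback x c')).flip
    rw [a₁]
    exact hX
  have hb : F.llp b := by
    refine IsTribe.anodyne_pullback (q := z') (i := j) (p := pullback.snd z c') ?_
      (MorphismProperty.pullback_snd _ _ hz) hj
    refine (IsPullback.of_right (h₁₂ := pullback.fst z c') (h₂₂ := c') (v₁₃ := z) (h₁₁ := b)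
      (v₁₁ := z') ?_ b₂ (IsPullback.of_hasPullback z c')).flip
    rw [b₁]
    exact hZ
  have := IsTribe.hasTerminal (F := F)
  -- As `Z'` is fibrant, the anodyne map `b` has a retraction. This makes `i'` a retract of `i' ≫ b
  -- = a ≫ k`, which is anodyne.
  obtain ⟨ρ, hρ, -⟩ := exists_lift_of_llp hb (IsTribe.fibrant (F := F) Z') (𝟙 _) (terminal.from _)
    (Subsingleton.elim _ _)
  have e : i' ≫ b = a ≫ k := by
    apply pullback.hom_ext
    · rw [Category.assoc, Category.assoc, b₁, hk₁, reassoc_of% a₁, h₁]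
    · rw [Category.assoc, Category.assoc, b₂, hk₂, a₂, reassoc_of% h₂]
  have hm : F.llp (i' ≫ b) := e ▸ MorphismProperty.comp_mem _ _ _ ha hk
  refine MorphismProperty.of_retract (P := F.llp) (f := i') (g := i' ≫ b) ?_ hm
  exact { i := Arrow.homMk (𝟙 _) b (by simp), r := Arrow.homMk (𝟙 _) ρ (by simp [hρ]),
          retract := by ext <;> simp [hρ] }

end Relative

/-! ### Homotopies in a tribe and in its fibrant slices -/

section Comparison

variable {C : Type u} [Category.{v} C] {F : MorphismProperty C}

/-- Construct a map of the fibrant slice. -/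
abbrev FibrantSlice.homMk {S : C} {A A' : FibrantSlice F S} (u : A.obj.left ⟶ A'.obj.left)
    (w : u ≫ A'.obj.hom = A.obj.hom) : A ⟶ A' :=
  ObjectProperty.homMk (Over.homMk u w)

lemma FibrantSlice.hom_ext {S : C} {A A' : FibrantSlice F S} {u v : A ⟶ A'}
    (h : u.hom.left = v.hom.left) : u = v := by
  ext; exact h

lemma FibrantSlice.w {S : C} {A A' : FibrantSlice F S} (u : A ⟶ A') :
    u.hom.left ≫ A'.obj.hom = A.obj.hom :=
  Over.w u.hom

lemma HomotopicOver.toTerminal [HasTerminal C] {X Y T : C} {f : X ⟶ Y} {g h : T ⟶ X}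
    (H : HomotopicOver F f g h) : HomotopicOver F (terminal.from X) g h := by
  have := H.postcomp (terminal.from X) (𝟙 X) (terminal.from Y) (Subsingleton.elim _ _)
  simpa only [Category.comp_id] using this

lemma HomotopicOver.postcomp_terminal [HasTerminal C] {X X' T : C} {g h : T ⟶ X}
    (H : HomotopicOver F (terminal.from X) g h) (u : X ⟶ X') :
    HomotopicOver F (terminal.from X') (g ≫ u) (h ≫ u) :=
  H.postcomp _ u (𝟙 _) (Subsingleton.elim _ _)

variable [IsTribe F]

/-- The strict fibre product is itself a fibration over `S`, so it competes with `sq` inside the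
fibrant slice, and the two are isomorphic. -/
lemma isPullback_of_isLimit_binaryFan {S : C} {A sq : FibrantSlice F S} (π₁ π₂ : sq ⟶ A)
    (h : IsLimit (BinaryFan.mk π₁ π₂)) :
    IsPullback π₁.hom.left π₂.hom.left A.obj.hom A.obj.hom := by
  let Q : FibrantSlice F S := FibrantSlice.of (pullback.fst A.obj.hom A.obj.hom ≫ A.obj.hom)
    (F.comp_mem _ _ (MorphismProperty.pullback_fst _ _ A.fib) A.fib)
  let p₁ : Q ⟶ A := FibrantSlice.homMk (pullback.fst A.obj.hom A.obj.hom) rfl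
  let p₂ : Q ⟶ A := FibrantSlice.homMk (pullback.snd A.obj.hom A.obj.hom) pullback.condition.symm
  obtain ⟨u, hu₁, hu₂⟩ : ∃ u : Q ⟶ sq, u ≫ π₁ = p₁ ∧ u ≫ π₂ = p₂ :=
    ⟨_, (BinaryFan.IsLimit.lift' h p₁ p₂).2⟩
  have w : π₁.hom.left ≫ A.obj.hom = π₂.hom.left ≫ A.obj.hom := by
    rw [FibrantSlice.w, FibrantSlice.w]
  let v : sq ⟶ Q := FibrantSlice.homMk (pullback.lift π₁.hom.left π₂.hom.left w)
    ((pullback.lift_fst_assoc _ _ _ _).trans (FibrantSlice.w π₁))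
  have hv₁ : v ≫ p₁ = π₁ := FibrantSlice.hom_ext (pullback.lift_fst _ _ _)
  have hv₂ : v ≫ p₂ = π₂ := FibrantSlice.hom_ext (pullback.lift_snd _ _ _)
  have huv : u ≫ v = 𝟙 _ := by
    apply FibrantSlice.hom_ext
    apply pullback.hom_ext
    · exact congrArg (fun k => k.hom.left) (show (u ≫ v) ≫ p₁ = 𝟙 _ ≫ p₁ by
        rw [Category.assoc, hv₁, hu₁, Category.id_comp])
    · exact congrArg (fun k => k.hom.left) (show (u ≫ v) ≫ p₂ = 𝟙 _ ≫ p₂ by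
        rw [Category.assoc, hv₂, hu₂, Category.id_comp])
  have hvu : v ≫ u = 𝟙 _ := by
    apply BinaryFan.IsLimit.hom_ext h
    · change (v ≫ u) ≫ π₁ = 𝟙 _ ≫ π₁
      rw [Category.assoc, hu₁, hv₁, Category.id_comp]
    · change (v ≫ u) ≫ π₂ = 𝟙 _ ≫ π₂
      rw [Category.assoc, hu₂, hv₂, Category.id_comp]
  exact IsPullback.of_iso_pullback ⟨w⟩
    ⟨v.hom.left, u.hom.left, congrArg (fun k => k.hom.left) hvu, congrArg (fun k => k.hom.left) huv⟩
    (pullback.lift_fst _ _ _) (pullback.lift_snd _ _ _)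

/-- The converse: a fibre product over `S` is a product in the fibrant slice. -/
noncomputable def isLimitBinaryFanOfIsPullback {S : C} {A sq : FibrantSlice F S} (π₁ π₂ : sq ⟶ A)
    (h : IsPullback π₁.hom.left π₂.hom.left A.obj.hom A.obj.hom) :
    IsLimit (BinaryFan.mk π₁ π₂) :=
  BinaryFan.isLimitMk
    (fun s => FibrantSlice.homMk (h.lift s.fst.hom.left s.snd.hom.left
        ((FibrantSlice.w s.fst).trans (FibrantSlice.w s.snd).symm))
      ((congrArg (_ ≫ ·) (FibrantSlice.w π₁).symm).trans
        ((h.lift_fst_assoc _ _ _ _).trans (FibrantSlice.w s.fst))))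
    (fun _ => FibrantSlice.hom_ext (h.lift_fst _ _ _))
    (fun _ => FibrantSlice.hom_ext (h.lift_snd _ _ _))
    (fun _ _ h₁ h₂ => FibrantSlice.hom_ext (h.hom_ext
      ((congrArg (fun k => k.hom.left) h₁).trans (h.lift_fst _ _ _).symm)
      ((congrArg (fun k => k.hom.left) h₂).trans (h.lift_snd _ _ _).symm)))

/-- A lifting problem against an arbitrary fibration is equivalent to one against its pullback to
`A'`, and that pullback lies in the fibrant slice. -/
lemma sliceFib_llp_iff {S : C} {A A' : FibrantSlice F S} (i : A ⟶ A') :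
    (sliceFib F S).llp i ↔ F.llp i.hom.left := by
  constructor
  · intro hi Z W p hp
    refine ⟨fun {f g} sq => ?_⟩
    have := IsTribe.hasPullback g p hp
    let Q : FibrantSlice F S := FibrantSlice.of (pullback.fst g p ≫ A'.obj.hom)
      (F.comp_mem _ _ (MorphismProperty.pullback_fst _ _ hp) A'.fib)
    let q : Q ⟶ A' := FibrantSlice.homMk (pullback.fst g p) rfl
    let a : A ⟶ Q := FibrantSlice.homMk (pullback.lift i.hom.left f sq.w.symm)
      ((pullback.lift_fst_assoc _ _ _ _).trans (FibrantSlice.w i))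
    obtain ⟨l, hl, hl'⟩ := exists_lift_of_llp hi
      (show sliceFib F S q from MorphismProperty.pullback_fst _ _ hp) a (𝟙 _)
      (FibrantSlice.hom_ext ((pullback.lift_fst _ _ _).trans (Category.comp_id _).symm))
    have hl₁ : i.hom.left ≫ l.hom.left = pullback.lift i.hom.left f sq.w.symm :=
      congrArg (fun k => k.hom.left) hl
    have hl₂ : l.hom.left ≫ pullback.fst g p = 𝟙 _ := congrArg (fun k => k.hom.left) hl'
    refine ⟨⟨⟨l.hom.left ≫ pullback.snd g p, ?_, ?_⟩⟩⟩
    · rw [reassoc_of% hl₁, pullback.lift_snd]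
    · rw [Category.assoc, ← pullback.condition, reassoc_of% hl₂]
  · intro hi Z W p hp
    refine ⟨fun {f g} sq => ?_⟩
    obtain ⟨l, hl, hl'⟩ := exists_lift_of_llp hi (show F p.hom.left from hp) f.hom.left g.hom.left
      (congrArg (fun k => k.hom.left) sq.w)
    exact ⟨⟨⟨FibrantSlice.homMk l (by rw [← FibrantSlice.w p, reassoc_of% hl', FibrantSlice.w]),
      FibrantSlice.hom_ext hl, FibrantSlice.hom_ext hl'⟩⟩⟩

/-- A path object in the fibrant slice, as a relative path object. -/
def PathObject.toRelative {S : C} {A : FibrantSlice F S} (P : PathObject (sliceFib F S) A) :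
    RelativePathObject F A.obj.hom where
  sq := P.sq.obj.left
  π₁ := P.π₁.hom.left
  π₂ := P.π₂.hom.left
  isPullback := isPullback_of_isLimit_binaryFan _ _ P.isLimit
  obj := P.obj.obj.left
  i := P.i.hom.left
  d := P.d.hom.left
  anodyne_i := (sliceFib_llp_iff _).1 P.anodyne_i
  fib_d := P.fib_d
  i_d₀ := congrArg (fun k => k.hom.left) P.i_d_π₁
  i_d₁ := congrArg (fun k => k.hom.left) P.i_d_π₂

/-- A relative path object of a fibration, as a path object in the fibrant slice. -/
noncomputable def RelativePathObject.toPathObject {S : C} {A : FibrantSlice F S}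
    (R : RelativePathObject F A.obj.hom) : PathObject (sliceFib F S) A :=
  have hsq : F (R.π₁ ≫ A.obj.hom) :=
    F.comp_mem _ _ (MorphismProperty.of_isPullback R.isPullback.flip A.fib) A.fib
  let sq : FibrantSlice F S := FibrantSlice.of (R.π₁ ≫ A.obj.hom) hsq
  let obj : FibrantSlice F S := FibrantSlice.of (R.d ≫ R.π₁ ≫ A.obj.hom)
    (F.comp_mem _ _ R.fib_d hsq)
  { sq := sq
    π₁ := FibrantSlice.homMk R.π₁ rfl
    π₂ := FibrantSlice.homMk R.π₂ R.isPullback.w.symm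
    isLimit := isLimitBinaryFanOfIsPullback _ _ R.isPullback
    obj := obj
    i := FibrantSlice.homMk (A := A) (A' := obj) R.i
      (by
        have h := R.i_d₀
        change R.i ≫ R.d ≫ R.π₁ ≫ A.obj.hom = _
        rw [reassoc_of% h])
    d := FibrantSlice.homMk R.d rfl
    anodyne_i := (sliceFib_llp_iff _).2 R.anodyne_i
    fib_d := R.fib_d
    i_d_π₁ := FibrantSlice.hom_ext R.i_d₀
    i_d_π₂ := FibrantSlice.hom_ext R.i_d₁ }

lemma homotopic_sliceFib_iff {S : C} {T A : FibrantSlice F S} (g h : T ⟶ A) :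
    Homotopic (sliceFib F S) g h ↔ HomotopicOver F A.obj.hom g.hom.left h.hom.left := by
  constructor
  · rintro ⟨P, t, rfl, rfl⟩
    let R := P.toRelative
    refine ⟨_, _, R.i, R.d ≫ R.π₁, R.d ≫ R.π₂, t.hom.left, R.anodyne_i, ?_, ?_, rfl, rfl⟩
    · rw [R.i_d₀, R.i_d₁]
    · rw [Category.assoc, R.isPullback.w, Category.assoc]
  · intro H
    obtain ⟨R⟩ := RelativePathObject.nonempty A.fib
    obtain ⟨t, h₀, h₁⟩ := H.exists_lift R
    refine ⟨R.toPathObject, FibrantSlice.homMk t ?_, FibrantSlice.hom_ext h₀,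
      FibrantSlice.hom_ext h₁⟩
    change t ≫ R.d ≫ R.π₁ ≫ A.obj.hom = _
    rw [reassoc_of% h₀, FibrantSlice.w]

lemma homotopic_iff [HasTerminal C] {T X : C} (g h : T ⟶ X) :
    Homotopic F g h ↔ HomotopicOver F (terminal.from X) g h := by
  constructor
  · rintro ⟨P, t, rfl, rfl⟩
    exact ⟨_, _, P.i, P.d₀, P.d₁, t, P.anodyne_i, P.i_d₀.trans P.i_d₁.symm, Subsingleton.elim _ _,
      rfl, rfl⟩
  · intro H
    obtain ⟨R⟩ := RelativePathObject.nonempty (IsTribe.fibrant (F := F) X)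
    obtain ⟨t, h₀, h₁⟩ := H.exists_lift R
    exact ⟨⟨R.sq, R.π₁, R.π₂,
      isProductOfIsTerminalIsPullback _ _ _ _ terminalIsTerminal R.isPullback.isLimit,
      R.obj, R.i, R.d, R.anodyne_i, R.fib_d, R.i_d₀, R.i_d₁⟩, t, h₀, h₁⟩

end Comparison

/-! ### Cartesian maps between objects of slices -/

section Cartesian

variable {C : Type u} [Category.{v} C] {S S' : C} {f : S' ⟶ S}

/-- A map over `f : S' ⟶ S` from an object of `C / S'` to an object of `C / S` is cartesian if it
exhibits its source as the pullback of its target along `f`. -/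
def IsCartesian {X' : Over S'} {X : Over S} (x : (Over.map f).obj X' ⟶ X) : Prop :=
  IsPullback (show X'.left ⟶ X.left from x.left) X'.hom X.hom f

namespace IsCartesian

variable {X' : Over S'} {X : Over S} {x : (Over.map f).obj X' ⟶ X} (hx : IsCartesian x)
include hx

/-- The factorisation of a map over `f` through a cartesian map. -/
noncomputable def lift {T : Over S'} (u : (Over.map f).obj T ⟶ X) : T ⟶ X' :=
  Over.homMk (IsPullback.lift hx u.left T.hom (Over.w u)) (IsPullback.lift_snd hx _ _ _)

lemma map_lift {T : Over S'} (u : (Over.map f).obj T ⟶ X) :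
    (Over.map f).map (hx.lift u) ≫ x = u := by
  ext; exact IsPullback.lift_fst hx _ _ _

lemma hom_ext {T : Over S'} {t t' : T ⟶ X'}
    (h : (Over.map f).map t ≫ x = (Over.map f).map t' ≫ x) : t = t' := by
  ext
  apply IsPullback.hom_ext hx
  · exact congrArg CommaMorphism.left h
  · exact (Over.w t).trans (Over.w t').symm

lemma isPullback_left {Y' : Over S'} {Y : Over S} {y : (Over.map f).obj Y' ⟶ Y}
    (hy : IsCartesian y) {u' : X' ⟶ Y'} {u : X ⟶ Y} (w : (Over.map f).map u' ≫ y = x ≫ u) :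
    IsPullback (show X'.left ⟶ X.left from x.left) u'.left u.left (show Y'.left ⟶ Y.left from y.left) := by
  refine IsPullback.of_bot (h₃₁ := f) (v₂₁ := Y'.hom) (v₂₂ := Y.hom) ?_
    (congrArg CommaMorphism.left w).symm hy
  rw [Over.w, Over.w]
  exact hx

end IsCartesian

/-- Base change preserves pullbacks, whatever pullbacks are chosen: by cartesianness, maps into a
primed corner are maps over `f` into the unprimed one. -/
lemma IsCartesian.isPullback {W' X' Y' Z' : Over S'} {W X Y Z : Over S}
    {w : (Over.map f).obj W' ⟶ W} {x : (Over.map f).obj X' ⟶ X} {y : (Over.map f).obj Y' ⟶ Y}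
    {z : (Over.map f).obj Z' ⟶ Z}
    (hw : IsCartesian w) (hx : IsCartesian x) (hy : IsCartesian y) (hz : IsCartesian z)
    {fst : W ⟶ X} {snd : W ⟶ Y} {l : X ⟶ Z} {r : Y ⟶ Z} (h : IsPullback fst snd l r)
    {fst' : W' ⟶ X'} {snd' : W' ⟶ Y'} {l' : X' ⟶ Z'} {r' : Y' ⟶ Z'}
    (h₁ : (Over.map f).map fst' ≫ x = w ≫ fst) (h₂ : (Over.map f).map snd' ≫ y = w ≫ snd)
    (h₃ : (Over.map f).map l' ≫ z = x ≫ l) (h₄ : (Over.map f).map r' ≫ z = y ≫ r) :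
    IsPullback fst' snd' l' r' := by
  have e : fst' ≫ l' = snd' ≫ r' := by
    apply hz.hom_ext
    simp only [Functor.map_comp, Category.assoc, h₃, h₄]
    rw [reassoc_of% h₁, reassoc_of% h₂, h.w]
  have key : ∀ {T : Over S'} (p : T ⟶ X') (q : T ⟶ Y'), p ≫ l' = q ≫ r' →
      ((Over.map f).map p ≫ x) ≫ l = ((Over.map f).map q ≫ y) ≫ r := by
    intro T p q hpq
    simp only [Category.assoc, ← h₃, ← h₄]
    rw [← Functor.map_comp_assoc, hpq, Functor.map_comp_assoc]
  refine ⟨⟨e⟩, ⟨PullbackCone.IsLimit.mk _ (fun s => hw.lift (h.lift _ _ (key s.fst s.snd s.condition)))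
    (fun s => hx.hom_ext ?_) (fun s => hy.hom_ext ?_) (fun s m hm₁ hm₂ => hw.hom_ext ?_)⟩⟩
  · rw [Functor.map_comp, Category.assoc, h₁, ← Category.assoc, hw.map_lift, h.lift_fst]
  · rw [Functor.map_comp, Category.assoc, h₂, ← Category.assoc, hw.map_lift, h.lift_snd]
  · rw [hw.map_lift]
    apply h.hom_ext
    · rw [h.lift_fst, Category.assoc, ← h₁, ← Functor.map_comp_assoc, hm₁]
    · rw [h.lift_snd, Category.assoc, ← h₂, ← Functor.map_comp_assoc, hm₂]

variable {F : MorphismProperty C} [IsTribe F]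

/-- The projection of a pulled back fibration. -/
noncomputable def baseChangeProj (f : S' ⟶ S) (A : FibrantSlice F S) :
    (Over.map f).obj (baseChange f A).obj ⟶ A.obj :=
  Over.homMk (pullback.snd f A.obj.hom) pullback.condition.symm

lemma baseChangeProj_isCartesian (f : S' ⟶ S) (A : FibrantSlice F S) :
    IsCartesian (baseChangeProj f A) :=
  (IsPullback.of_hasPullback f A.obj.hom).flip

lemma exists_isCartesian (hf : F f) (X : Over S) :
    ∃ (X' : Over S') (x : (Over.map f).obj X' ⟶ X), IsCartesian x := by
  have := IsTribe.hasPullback X.hom f hf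
  exact ⟨Over.mk (pullback.snd X.hom f), Over.homMk (pullback.fst X.hom f) pullback.condition,
    IsPullback.of_hasPullback X.hom f⟩

/-! ### Products and cartesian maps -/

section Prod

variable {A : FibrantSlice F S} {A' : FibrantSlice F S'} {X' : Over S'} {X : Over S}

/-- The product of two maps over `f`. -/
noncomputable def prodMap (a : (Over.map f).obj A'.obj ⟶ A.obj) (x : (Over.map f).obj X' ⟶ X) :
    (Over.map f).obj (prodObj X' A') ⟶ prodObj X A :=
  plift ((Over.map f).map (pfst X' A') ≫ x) ((Over.map f).map (psnd X' A') ≫ a)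

variable (a : (Over.map f).obj A'.obj ⟶ A.obj)

lemma prodMap_pfst (x : (Over.map f).obj X' ⟶ X) :
    prodMap a x ≫ pfst X A = (Over.map f).map (pfst X' A') ≫ x :=
  plift_pfst _ _

lemma prodMap_psnd (x : (Over.map f).obj X' ⟶ X) :
    prodMap a x ≫ psnd X A = (Over.map f).map (psnd X' A') ≫ a :=
  plift_psnd _ _

lemma comp_plift {T Y : Over S} (t : T ⟶ Y) (u : Y ⟶ X) (v : Y ⟶ A.obj) :
    t ≫ plift u v = plift (t ≫ u) (t ≫ v) := by
  apply prod_hom_ext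
  · rw [Category.assoc, plift_pfst, plift_pfst]
  · rw [Category.assoc, plift_psnd, plift_psnd]

lemma map_plift_prodMap (x : (Over.map f).obj X' ⟶ X) {T : Over S'} (u : T ⟶ X') (v : T ⟶ A'.obj) :
    (Over.map f).map (plift u v) ≫ prodMap a x =
      plift ((Over.map f).map u ≫ x) ((Over.map f).map v ≫ a) := by
  apply prod_hom_ext
  · rw [Category.assoc, prodMap_pfst, plift_pfst, ← Functor.map_comp_assoc, plift_pfst]
  · rw [Category.assoc, prodMap_psnd, plift_psnd, ← Functor.map_comp_assoc, plift_psnd]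

lemma prodMap_comp (x : (Over.map f).obj X' ⟶ X) {Y : Over S} (y : X ⟶ Y) :
    prodMap a x ≫ (prodFunctor A).map y = prodMap a (x ≫ y) := by
  apply prod_hom_ext
  · rw [Category.assoc, map_pfst, prodMap_pfst, ← Category.assoc, prodMap_pfst, Category.assoc]
  · rw [Category.assoc, map_psnd, prodMap_psnd, prodMap_psnd]

lemma map_prodMap (x : (Over.map f).obj X' ⟶ X) {T : Over S'} (t : T ⟶ X') :
    (Over.map f).map ((prodFunctor A').map t) ≫ prodMap a x = prodMap a ((Over.map f).map t ≫ x) := by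
  apply prod_hom_ext
  · rw [Category.assoc, prodMap_pfst, prodMap_pfst, ← Functor.map_comp_assoc, map_pfst,
      Functor.map_comp_assoc]
  · rw [Category.assoc, prodMap_psnd, prodMap_psnd, ← Functor.map_comp_assoc, map_psnd]

variable {a}

/-- Frobenius reciprocity: `T × f^* A`, viewed over `S`, is `T × A`. The base change of internal
homs and of dependent products both come from this isomorphism. -/
lemma IsCartesian.isIso_prodMap (ha : IsCartesian a) (T : Over S') :
    IsIso (prodMap a (𝟙 ((Over.map f).obj T))) := by
  let s : (prodObj ((Over.map f).obj T) A).left ⟶ A'.obj.left :=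
    IsPullback.lift ha (psnd ((Over.map f).obj T) A).left ((pfst ((Over.map f).obj T) A).left ≫ T.hom)
      ((Over.w (psnd ((Over.map f).obj T) A)).trans
        ((Over.w (pfst ((Over.map f).obj T) A)).symm.trans (Category.assoc _ _ _).symm))
  have hs₁ : s ≫ a.left = (psnd ((Over.map f).obj T) A).left := IsPullback.lift_fst ha _ _ _
  have hs₂ : s ≫ A'.obj.hom = (pfst ((Over.map f).obj T) A).left ≫ T.hom :=
    IsPullback.lift_snd ha _ _ _
  let r : (prodObj ((Over.map f).obj T) A).left ⟶ (prodObj T A').left :=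
    pullback.lift (pfst ((Over.map f).obj T) A).left s hs₂.symm
  have hr₁ : r ≫ (pfst T A').left = (pfst ((Over.map f).obj T) A).left := pullback.lift_fst _ _ _
  have hr₂ : r ≫ (psnd T A').left = s := pullback.lift_snd _ _ _
  let ρ : prodObj ((Over.map f).obj T) A ⟶ (Over.map f).obj (prodObj T A') :=
    Over.homMk r (by
      refine Eq.trans (congrArg (r ≫ ·) (Over.w ((Over.map f).map (pfst T A'))).symm) ?_
      exact (Category.assoc _ _ _).symm.trans ((congrArg (· ≫ _) hr₁).trans (Over.w _)))
  have hρ₁ : ρ ≫ (Over.map f).map (pfst T A') = pfst _ A := by ext; exact hr₁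
  have hρ₂ : ρ ≫ (Over.map f).map (psnd T A') ≫ a = psnd _ A := by
    ext
    exact (Category.assoc _ _ _).symm.trans ((congrArg (· ≫ a.left) hr₂).trans hs₁)
  refine ⟨ρ, ?_, ?_⟩
  · ext
    apply pullback.hom_ext (f := T.hom) (g := A'.obj.hom)
    · exact congrArg CommaMorphism.left
        (show (prodMap a (𝟙 _) ≫ ρ) ≫ (Over.map f).map (pfst T A') = 𝟙 _ ≫ (Over.map f).map (pfst T A') by
          rw [Category.assoc, hρ₁, prodMap_pfst, Category.comp_id, Category.id_comp])
    · apply IsPullback.hom_ext ha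
      · exact congrArg CommaMorphism.left
          (show ((prodMap a (𝟙 _) ≫ ρ) ≫ (Over.map f).map (psnd T A')) ≫ a =
              (𝟙 _ ≫ (Over.map f).map (psnd T A')) ≫ a by
            rw [Category.assoc, Category.assoc, hρ₂, prodMap_psnd, Category.id_comp])
      · have e : ∀ k : (prodObj T A').left ⟶ (prodObj T A').left,
            k ≫ (psnd T A').left ≫ A'.obj.hom = k ≫ (pfst T A').left ≫ T.hom := fun k => by
          rw [Over.w, Over.w]
        have e' : (prodMap a (𝟙 _)).left ≫ r ≫ (pfst T A').left = (pfst T A').left := by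
          rw [hr₁]
          exact (congrArg CommaMorphism.left (prodMap_pfst a (𝟙 ((Over.map f).obj T)))).trans
            (Category.comp_id _)
        refine (Category.assoc _ _ _).trans ((e _).trans (Eq.trans ?_ ((e (𝟙 _)).symm.trans (Category.assoc _ _ _).symm)))
        refine (Category.assoc _ _ _).symm.trans ?_
        refine Eq.trans (congrArg (· ≫ T.hom) ((Category.assoc _ _ _).trans e')) ?_
        exact (Category.id_comp _).symm
  · apply prod_hom_ext
    · rw [Category.assoc, prodMap_pfst, Category.comp_id, hρ₁, Category.id_comp]
    · rw [Category.assoc, prodMap_psnd, hρ₂, Category.id_comp]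

lemma IsCartesian.prodMap {x : (Over.map f).obj X' ⟶ X} (ha : IsCartesian a) (hx : IsCartesian x) :
    IsCartesian (prodMap a x) := by
  have h₁ : IsPullback (pfst X' A').left (psnd X' A').left X'.hom A'.obj.hom :=
    IsPullback.of_hasPullback X'.hom A'.obj.hom
  have h₂ : IsPullback (pfst X A).left (psnd X A).left X.hom A.obj.hom :=
    IsPullback.of_hasPullback X.hom A.obj.hom
  have e₂ : (show (prodObj X' A').left ⟶ (prodObj X A).left from (Tribes.prodMap a x).left) ≫
      (psnd X A).left = (psnd X' A').left ≫ a.left :=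
    congrArg CommaMorphism.left (prodMap_psnd a x)
  have e₁ : (show (prodObj X' A').left ⟶ (prodObj X A).left from (Tribes.prodMap a x).left) ≫
      (pfst X A).left = (pfst X' A').left ≫ x.left :=
    congrArg CommaMorphism.left (prodMap_pfst a x)
  have key : IsPullback (show (prodObj X' A').left ⟶ (prodObj X A).left from (Tribes.prodMap a x).left)
      (pfst X' A').left (pfst X A).left (show X'.left ⟶ X.left from x.left) := by
    refine IsPullback.of_right (h₁₂ := (psnd X A).left) (h₂₂ := X.hom) (v₁₃ := A.obj.hom) ?_ e₁ h₂.flip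
    rw [e₂, show (show X'.left ⟶ X.left from x.left) ≫ X.hom = X'.hom ≫ f from hx.w]
    exact h₁.flip.paste_horiz ha
  have := key.paste_vert hx
  rwa [Over.w, Over.w] at this

end Prod

end Cartesian

/-! ### Base change of path objects -/

section PathObjects

variable {C : Type u} [Category.{v} C] {F : MorphismProperty C} [IsTribe F] {S S' : C} {f : S' ⟶ S}
  {A : FibrantSlice F S} {A' : FibrantSlice F S'}

lemma PathObject.sq_hom_ext (P : PathObject (sliceFib F S) A) {T : Over S} {u v : T ⟶ P.sq.obj}
    (h₁ : u ≫ P.π₁.hom = v ≫ P.π₁.hom) (h₂ : u ≫ P.π₂.hom = v ≫ P.π₂.hom) : u = v := by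
  ext
  exact P.toRelative.isPullback.hom_ext (congrArg CommaMorphism.left h₁) (congrArg CommaMorphism.left h₂)

/-- The map to the square of a path object with given components. -/
noncomputable def PathObject.sqLift (P : PathObject (sliceFib F S) A) {T : Over S}
    (u v : T ⟶ A.obj) : T ⟶ P.sq.obj :=
  Over.homMk (P.toRelative.isPullback.lift u.left v.left ((Over.w u).trans (Over.w v).symm))
    ((congrArg (_ ≫ ·) (FibrantSlice.w P.π₁).symm).trans
      ((P.toRelative.isPullback.lift_fst_assoc _ _ _ _).trans (Over.w u)))

lemma PathObject.sqLift_π₁ (P : PathObject (sliceFib F S) A) {T : Over S} (u v : T ⟶ A.obj) :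
    P.sqLift u v ≫ P.π₁.hom = u := by
  ext; exact P.toRelative.isPullback.lift_fst _ _ _

lemma PathObject.sqLift_π₂ (P : PathObject (sliceFib F S) A) {T : Over S} (u v : T ⟶ A.obj) :
    P.sqLift u v ≫ P.π₂.hom = v := by
  ext; exact P.toRelative.isPullback.lift_snd _ _ _

variable {a : (Over.map f).obj A'.obj ⟶ A.obj}

/-- The base change of a map of fibrations. -/
noncomputable def IsCartesian.baseChangeMap (ha : IsCartesian a) {Z : FibrantSlice F S} (u : Z ⟶ A) :
    baseChange f Z ⟶ A' :=
  ObjectProperty.homMk (ha.lift (baseChangeProj f Z ≫ u.hom))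

lemma IsCartesian.map_baseChangeMap (ha : IsCartesian a) {Z : FibrantSlice F S} (u : Z ⟶ A) :
    (Over.map f).map (ha.baseChangeMap u).hom ≫ a = baseChangeProj f Z ≫ u.hom :=
  ha.map_lift _

/-- The base change of a path object. -/
noncomputable def PathObject.pull (P : PathObject (sliceFib F S) A) (ha : IsCartesian a) :
    PathObject (sliceFib F S') A' where
  sq := baseChange f P.sq
  π₁ := ha.baseChangeMap P.π₁
  π₂ := ha.baseChangeMap P.π₂
  isLimit :=
    BinaryFan.isLimitMk
      (fun s => ObjectProperty.homMk ((baseChangeProj_isCartesian f P.sq).lift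
        (P.sqLift ((Over.map f).map s.fst.hom ≫ a) ((Over.map f).map s.snd.hom ≫ a))))
      (fun s => by
        ext : 1
        refine ha.hom_ext ?_
        change (Over.map f).map (_ ≫ (ha.baseChangeMap P.π₁).hom) ≫ a = _
        rw [Functor.map_comp, Category.assoc, ha.map_baseChangeMap, ← Category.assoc]
        refine (congrArg (· ≫ P.π₁.hom) (IsCartesian.map_lift _ _)).trans ?_
        exact P.sqLift_π₁ _ _)
      (fun s => by
        ext : 1
        refine ha.hom_ext ?_
        change (Over.map f).map (_ ≫ (ha.baseChangeMap P.π₂).hom) ≫ a = _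
        rw [Functor.map_comp, Category.assoc, ha.map_baseChangeMap, ← Category.assoc]
        refine (congrArg (· ≫ P.π₂.hom) (IsCartesian.map_lift _ _)).trans ?_
        exact P.sqLift_π₂ _ _)
      (fun s m h₁ h₂ => by
        ext : 1
        refine (baseChangeProj_isCartesian f P.sq).hom_ext ?_
        refine Eq.trans ?_ (IsCartesian.map_lift _ _).symm
        apply P.sq_hom_ext
        · rw [P.sqLift_π₁, Category.assoc, ← ha.map_baseChangeMap, ← Functor.map_comp_assoc]
          exact congrArg (fun k => (Over.map f).map k.hom ≫ a) h₁
        · rw [P.sqLift_π₂, Category.assoc, ← ha.map_baseChangeMap, ← Functor.map_comp_assoc]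
          exact congrArg (fun k => (Over.map f).map k.hom ≫ a) h₂)
  obj := baseChange f P.obj
  i := ObjectProperty.homMk ((baseChangeProj_isCartesian f P.obj).lift (a ≫ P.i.hom))
  d := (baseChangeProj_isCartesian f P.sq).baseChangeMap P.d
  anodyne_i := by
    rw [sliceFib_llp_iff]
    -- Here `f` is arbitrary, so axiom (iv) alone would not suffice; it matters that the anodyne map
    -- lies between fibrations over `S`.
    refine anodyne_baseChange (P.toRelative.anodyne_i) A.fib P.obj.fib (FibrantSlice.w P.i) ha
      (baseChangeProj_isCartesian f P.obj) ?_ (Over.w _)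
    exact congrArg CommaMorphism.left ((baseChangeProj_isCartesian f P.obj).map_lift (a ≫ P.i.hom))
  fib_d := MorphismProperty.of_isPullback (P := F)
    ((baseChangeProj_isCartesian f P.obj).isPullback_left (baseChangeProj_isCartesian f P.sq)
      (IsCartesian.map_baseChangeMap _ P.d)) P.fib_d
  i_d_π₁ := by
    ext : 1
    apply ha.hom_ext
    simp only [ObjectProperty.FullSubcategory.comp_hom, Functor.map_comp, Category.assoc,
      IsCartesian.map_baseChangeMap]
    rw [reassoc_of% (IsCartesian.map_baseChangeMap (baseChangeProj_isCartesian f P.sq) P.d)]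
    have h := congrArg (fun k => k.hom) P.i_d_π₁
    simp only [ObjectProperty.FullSubcategory.comp_hom] at h
    refine (Category.assoc _ _ _).symm.trans ((congrArg (· ≫ _) (IsCartesian.map_lift _ _)).trans ?_)
    rw [Category.assoc, h]
    simp
  i_d_π₂ := by
    ext : 1
    apply ha.hom_ext
    simp only [ObjectProperty.FullSubcategory.comp_hom, Functor.map_comp, Category.assoc,
      IsCartesian.map_baseChangeMap]
    rw [reassoc_of% (IsCartesian.map_baseChangeMap (baseChangeProj_isCartesian f P.sq) P.d)]
    have h := congrArg (fun k => k.hom) P.i_d_π₂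
    simp only [ObjectProperty.FullSubcategory.comp_hom] at h
    refine (Category.assoc _ _ _).symm.trans ((congrArg (· ≫ _) (IsCartesian.map_lift _ _)).trans ?_)
    rw [Category.assoc, h]
    simp

lemma PathObject.pull_i (P : PathObject (sliceFib F S) A) (ha : IsCartesian a) :
    (Over.map f).map (P.pull ha).i.hom ≫ baseChangeProj f P.obj = a ≫ P.i.hom :=
  IsCartesian.map_lift _ _

lemma PathObject.pull_d (P : PathObject (sliceFib F S) A) (ha : IsCartesian a) :
    (Over.map f).map (P.pull ha).d.hom ≫ baseChangeProj f P.sq = baseChangeProj f P.obj ≫ P.d.hom :=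
  IsCartesian.map_lift _ _

lemma PathObject.pull_d₀ (P : PathObject (sliceFib F S) A) (ha : IsCartesian a) :
    (Over.map f).map (P.pull ha).d₀.hom ≫ a = baseChangeProj f P.obj ≫ P.d₀.hom := by
  have h₁ : (Over.map f).map (P.pull ha).π₁.hom ≫ a = baseChangeProj f P.sq ≫ P.π₁.hom :=
    ha.map_baseChangeMap _
  simp only [PathObject.d₀, ObjectProperty.FullSubcategory.comp_hom, Functor.map_comp,
    Category.assoc, h₁]
  exact (Category.assoc _ _ _).symm.trans ((congrArg (· ≫ _) (P.pull_d ha)).trans (Category.assoc _ _ _))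

lemma PathObject.pull_d₁ (P : PathObject (sliceFib F S) A) (ha : IsCartesian a) :
    (Over.map f).map (P.pull ha).d₁.hom ≫ a = baseChangeProj f P.obj ≫ P.d₁.hom := by
  have h₁ : (Over.map f).map (P.pull ha).π₂.hom ≫ a = baseChangeProj f P.sq ≫ P.π₂.hom :=
    ha.map_baseChangeMap _
  simp only [PathObject.d₁, ObjectProperty.FullSubcategory.comp_hom, Functor.map_comp,
    Category.assoc, h₁]
  exact (Category.assoc _ _ _).symm.trans ((congrArg (· ≫ _) (P.pull_d ha)).trans (Category.assoc _ _ _))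

end PathObjects

/-! ### Base change of internal homs -/

section InternalHoms

variable {C : Type u} [Category.{v} C] {F : MorphismProperty C} [IsTribe F] {S S' : C} {f : S' ⟶ S}

namespace InternalHom

variable {A Z : FibrantSlice F S} {A' Z' : FibrantSlice F S'}
  {a : (Over.map f).obj A'.obj ⟶ A.obj} {z : (Over.map f).obj Z'.obj ⟶ Z.obj}

lemma curry_uncurry (H : InternalHom A Z) {X : Over S} (t : X ⟶ H.obj.obj) :
    H.curry (H.uncurry t) = t :=
  H.repr.homEquiv.symm_apply_apply t

/-- The base change of an internal hom. -/
noncomputable def pull (H : InternalHom A Z) (ha : IsCartesian a) (hz : IsCartesian z) :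
    InternalHom A' Z' where
  obj := baseChange f H.obj
  repr :=
    -- Maps from `T` to the pulled back hom are maps over `f` from `T` to `Hom(A, Z)`, hence maps `T
    -- × A ⟶ Z` over `S`. By Frobenius reciprocity and cartesianness of `z`, these are maps `T × A'
    -- ⟶ Z'` over `S'`.
    { homEquiv := fun {T} =>
        { toFun := fun t => hz.lift (prodMap a (𝟙 _) ≫
            H.uncurry ((Over.map f).map t ≫ baseChangeProj f H.obj))
          invFun := fun (k : prodObj T A' ⟶ Z'.obj) => (baseChangeProj_isCartesian f H.obj).lift
            (H.curry (haveI := ha.isIso_prodMap T; inv (prodMap a (𝟙 _)) ≫ (Over.map f).map k ≫ z))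
          left_inv := fun t => by
            have := ha.isIso_prodMap T
            apply (baseChangeProj_isCartesian f H.obj).hom_ext
            rw [IsCartesian.map_lift]
            refine (congrArg (fun k => H.curry (inv (prodMap a (𝟙 _)) ≫ k)) (hz.map_lift _)).trans ?_
            rw [IsIso.inv_hom_id_assoc, curry_uncurry]
          right_inv := fun k => by
            have := ha.isIso_prodMap T
            apply hz.hom_ext
            refine (hz.map_lift _).trans ?_
            rw [IsCartesian.map_lift, uncurry_curry, IsIso.hom_inv_id_assoc] }
      homEquiv_comp := fun {T T'} g t => by
        apply hz.hom_ext
        refine (hz.map_lift _).trans ?_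
        have e : (Over.map f).map ((prodFunctor A').map g ≫ hz.lift (prodMap a (𝟙 _) ≫
            H.uncurry ((Over.map f).map t ≫ baseChangeProj f H.obj))) ≫ z =
            prodMap a (𝟙 _) ≫ H.uncurry ((Over.map f).map (g ≫ t) ≫ baseChangeProj f H.obj) := by
          rw [Functor.map_comp, Category.assoc, hz.map_lift, ← Category.assoc, map_prodMap,
            Category.comp_id, Functor.map_comp, Category.assoc,
            H.uncurry_comp ((Over.map f).map g), ← Category.assoc, prodMap_comp, Category.id_comp]
        exact e.symm }

/-- An internal hom over `S'` is compatible with an internal hom over `S`, by a map `η` over `f`, if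
transposition is compatible with the maps over `f`. -/
def Compatible (H' : InternalHom A' Z') (H : InternalHom A Z) (a : (Over.map f).obj A'.obj ⟶ A.obj)
    (z : (Over.map f).obj Z'.obj ⟶ Z.obj) (η : (Over.map f).obj H'.obj.obj ⟶ H.obj.obj) : Prop :=
  ∀ {T : Over S'} (t : T ⟶ H'.obj.obj),
    (Over.map f).map (H'.uncurry t) ≫ z = prodMap a (𝟙 _) ≫ H.uncurry ((Over.map f).map t ≫ η)

lemma exists_compatible (H : InternalHom A Z) (ha : IsCartesian a) (hz : IsCartesian z) :
    ∃ (H' : InternalHom A' Z') (η : (Over.map f).obj H'.obj.obj ⟶ H.obj.obj),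
      IsCartesian η ∧ H'.Compatible H a z η :=
  ⟨H.pull ha hz, baseChangeProj f H.obj, baseChangeProj_isCartesian f H.obj,
    fun _ => hz.map_lift _⟩

namespace Compatible

variable {H : InternalHom A Z} {H' : InternalHom A' Z'}
  {η : (Over.map f).obj H'.obj.obj ⟶ H.obj.obj} (hη : H'.Compatible H a z η)
include hη

lemma map_uncurry {X' : Over S'} {X : Over S} (x : (Over.map f).obj X' ⟶ X)
    {t' : X' ⟶ H'.obj.obj} {t : X ⟶ H.obj.obj} (h : (Over.map f).map t' ≫ η = x ≫ t) :
    (Over.map f).map (H'.uncurry t') ≫ z = prodMap a x ≫ H.uncurry t := by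
  rw [hη t', h, uncurry_comp, ← Category.assoc, prodMap_comp, Category.id_comp]

lemma map_curry (ha : IsCartesian a) {X' : Over S'} {X : Over S} (x : (Over.map f).obj X' ⟶ X)
    {k' : prodObj X' A' ⟶ Z'.obj} {k : prodObj X A ⟶ Z.obj}
    (h : (Over.map f).map k' ≫ z = prodMap a x ≫ k) :
    (Over.map f).map (H'.curry k') ≫ η = x ≫ H.curry k := by
  have := ha.isIso_prodMap X'
  rw [← H.curry_uncurry (_ ≫ η), comp_curry]
  congr 1
  rw [← cancel_epi (prodMap a (𝟙 ((Over.map f).obj X'))), ← hη, uncurry_curry, h,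
    ← Category.assoc, prodMap_comp, Category.id_comp]

lemma map_post (ha : IsCartesian a) {Z₂ : FibrantSlice F S} {Z₂' : FibrantSlice F S'}
    {z₂ : (Over.map f).obj Z₂'.obj ⟶ Z₂.obj} {H₂ : InternalHom A Z₂} {H₂' : InternalHom A' Z₂'}
    {η₂ : (Over.map f).obj H₂'.obj.obj ⟶ H₂.obj.obj} (hη₂ : H₂'.Compatible H₂ a z₂ η₂)
    {u' : Z' ⟶ Z₂'} {u : Z ⟶ Z₂} (h : (Over.map f).map u'.hom ≫ z₂ = z ≫ u.hom) :
    (Over.map f).map (H'.post H₂' u') ≫ η₂ = η ≫ H.post H₂ u := by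
  refine hη₂.map_curry ha _ ?_
  rw [Functor.map_comp, Category.assoc, h, ← Category.assoc, hη.map_uncurry η (t := 𝟙 _) (by simp),
    Category.assoc]

end Compatible

end InternalHom

section

variable {A B D : FibrantSlice F S} {A' B' D' : FibrantSlice F S'}
  {a : (Over.map f).obj A'.obj ⟶ A.obj} {b : (Over.map f).obj B'.obj ⟶ B.obj}
  {d : (Over.map f).obj D'.obj ⟶ D.obj} {X' : Over S'} {X : Over S}

lemma map_compOver_of_over (x : (Over.map f).obj X' ⟶ X) {g' : prodObj X' B' ⟶ D'.obj}
    {g : prodObj X B ⟶ D.obj} {e' : prodObj X' A' ⟶ B'.obj} {e : prodObj X A ⟶ B.obj}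
    (hg : (Over.map f).map g' ≫ d = prodMap b x ≫ g)
    (he : (Over.map f).map e' ≫ b = prodMap a x ≫ e) :
    (Over.map f).map (compOver g' e') ≫ d = prodMap a x ≫ compOver g e := by
  rw [compOver, compOver, Functor.map_comp, Category.assoc, hg, ← Category.assoc, ← Category.assoc,
    map_plift_prodMap, comp_plift, prodMap_pfst, he]

lemma map_internalComp (ha : IsCartesian a) {HBD : InternalHom B D} {HAB : InternalHom A B}
    {HAD : InternalHom A D}
    {HBD' : InternalHom B' D'} {HAB' : InternalHom A' B'} {HAD' : InternalHom A' D'}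
    {ηBD : (Over.map f).obj HBD'.obj.obj ⟶ HBD.obj.obj} (hBD : HBD'.Compatible HBD b d ηBD)
    {ηAB : (Over.map f).obj HAB'.obj.obj ⟶ HAB.obj.obj} (hAB : HAB'.Compatible HAB a b ηAB)
    {ηAD : (Over.map f).obj HAD'.obj.obj ⟶ HAD.obj.obj} (hAD : HAD'.Compatible HAD a d ηAD) :
    (Over.map f).map (internalComp HBD' HAB' HAD') ≫ ηAD =
      prodMap ηAB ηBD ≫ internalComp HBD HAB HAD :=
  hAD.map_curry ha _ (map_compOver_of_over _ (hBD.map_uncurry _ (prodMap_pfst _ _).symm)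
    (hAB.map_uncurry _ (prodMap_psnd _ _).symm))

lemma map_compConst (ha : IsCartesian a) {HBA : InternalHom B A} {HAB : InternalHom A B}
    {HAA : InternalHom A A}
    {HBA' : InternalHom B' A'} {HAB' : InternalHom A' B'} {HAA' : InternalHom A' A'}
    {ηBA : (Over.map f).obj HBA'.obj.obj ⟶ HBA.obj.obj} (hBA : HBA'.Compatible HBA b a ηBA)
    {ηAB : (Over.map f).obj HAB'.obj.obj ⟶ HAB.obj.obj} (hAB : HAB'.Compatible HAB a b ηAB)
    {ηAA : (Over.map f).obj HAA'.obj.obj ⟶ HAA.obj.obj} (hAA : HAA'.Compatible HAA a a ηAA) :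
    (Over.map f).map (compConst HBA' HAB' HAA') ≫ prodMap ηAA ηAA =
      prodMap ηAB ηBA ≫ compConst HBA HAB HAA := by
  rw [compConst, compConst, map_plift_prodMap, comp_plift, map_internalComp ha hBA hAB hAA]
  congr 1
  exact hAA.map_curry ha _ (prodMap_psnd _ _).symm

lemma map_pathEnds (ha : IsCartesian a) {P : PathObject (sliceFib F S) A} {HAP : InternalHom A P.obj}
    {HAA : InternalHom A A} {HAP' : InternalHom A' (P.pull ha).obj} {HAA' : InternalHom A' A'}
    {ηAP : (Over.map f).obj HAP'.obj.obj ⟶ HAP.obj.obj}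
    (hAP : HAP'.Compatible HAP a (baseChangeProj f P.obj) ηAP)
    {ηAA : (Over.map f).obj HAA'.obj.obj ⟶ HAA.obj.obj} (hAA : HAA'.Compatible HAA a a ηAA) :
    (Over.map f).map (pathEnds (P.pull ha) HAP' HAA') ≫ prodMap ηAA ηAA =
      ηAP ≫ pathEnds P HAP HAA := by
  rw [pathEnds, pathEnds, map_plift_prodMap, comp_plift,
    hAP.map_post ha hAA (P.pull_d₀ ha), hAP.map_post ha hAA (P.pull_d₁ ha)]

/-! ### Base change of objects of equivalences -/

/-- All ingredients are internal homs, path objects and pullbacks, so pulling each one back gives a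
valid set of choices over `S'`. The second half says that transposition and pairing respect these
base changes, so maps defined from data over `f` correspond. That `f` is a fibration ensures that
`RInv`, `LInv` and `obj`, which are only objects of `C / S`, have pullbacks along it. -/
theorem ObjectOfEquivalences.exists_pull (hf : F f) {PA : PathObject (sliceFib F S) A}
    {PB : PathObject (sliceFib F S) B} (O : ObjectOfEquivalences PA PB)
    (ha : IsCartesian a) (hb : IsCartesian b) :
    ∃ (O' : ObjectOfEquivalences (PA.pull ha) (PB.pull hb))
      (φ : (Over.map f).obj O'.obj ⟶ O.obj), IsCartesian φ ∧
      ∀ {X' : Over S'} {X : Over S} (x : (Over.map f).obj X' ⟶ X)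
        (e' : prodObj X' A' ⟶ B'.obj) (g' h' : prodObj X' B' ⟶ A'.obj)
        (H' : prodObj X' A' ⟶ (PA.pull ha).obj.obj) (K' : prodObj X' B' ⟶ (PB.pull hb).obj.obj)
        (e : prodObj X A ⟶ B.obj) (g h : prodObj X B ⟶ A.obj)
        (H : prodObj X A ⟶ PA.obj.obj) (K : prodObj X B ⟶ PB.obj.obj)
        (H₀' : H' ≫ (PA.pull ha).d₀.hom = compOver g' e')
        (H₁' : H' ≫ (PA.pull ha).d₁.hom = psnd X' A')
        (K₀' : K' ≫ (PB.pull hb).d₀.hom = compOver e' h')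
        (K₁' : K' ≫ (PB.pull hb).d₁.hom = psnd X' B')
        (H₀ : H ≫ PA.d₀.hom = compOver g e) (H₁ : H ≫ PA.d₁.hom = psnd X A)
        (K₀ : K ≫ PB.d₀.hom = compOver e h) (K₁ : K ≫ PB.d₁.hom = psnd X B),
        (Over.map f).map e' ≫ b = prodMap a x ≫ e →
        (Over.map f).map g' ≫ a = prodMap b x ≫ g →
        (Over.map f).map h' ≫ a = prodMap b x ≫ h →
        (Over.map f).map H' ≫ baseChangeProj f PA.obj = prodMap a x ≫ H →
        (Over.map f).map K' ≫ baseChangeProj f PB.obj = prodMap b x ≫ K →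
        (Over.map f).map (O'.lift e' g' h' H' K' H₀' H₁' K₀' K₁') ≫ φ =
          x ≫ O.lift e g h H K H₀ H₁ K₀ K₁ := by
  obtain ⟨HAB', ηAB, cAB, hAB⟩ := O.HAB.exists_compatible ha hb
  obtain ⟨HBA', ηBA, cBA, hBA⟩ := O.HBA.exists_compatible hb ha
  obtain ⟨HAA', ηAA, cAA, hAA⟩ := O.HAA.exists_compatible ha ha
  obtain ⟨HBB', ηBB, cBB, hBB⟩ := O.HBB.exists_compatible hb hb
  obtain ⟨HAP', ηAP, cAP, hAP⟩ := O.HAPA.exists_compatible ha (baseChangeProj_isCartesian f PA.obj)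
  obtain ⟨HBP', ηBP, cBP, hBP⟩ := O.HBPB.exists_compatible hb (baseChangeProj_isCartesian f PB.obj)
  obtain ⟨R', ρ, cR⟩ := exists_isCartesian hf O.RInv
  obtain ⟨L', l, cL⟩ := exists_isCartesian hf O.LInv
  obtain ⟨Q', φ, cQ⟩ := exists_isCartesian hf O.obj
  have cABBA := IsCartesian.prodMap cBA cAB
  have cBAAB := IsCartesian.prodMap cAB cBA
  let O' : ObjectOfEquivalences (PA.pull ha) (PB.pull hb) :=
    { HAB := HAB', HBA := HBA', HAA := HAA', HBB := HBB', HAPA := HAP', HBPB := HBP'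
      RInv := R'
      rTop := cBP.lift (ρ ≫ O.rTop)
      rProj := cABBA.lift (ρ ≫ O.rProj)
      rInv_isPullback := cR.isPullback cBP cABBA (IsCartesian.prodMap cBB cBB) O.rInv_isPullback
        (cBP.map_lift _) (cABBA.map_lift _) (map_pathEnds hb hBP hBB) (map_compConst hb hAB hBA hBB)
      LInv := L'
      lTop := cAP.lift (l ≫ O.lTop)
      lProj := cBAAB.lift (l ≫ O.lProj)
      lInv_isPullback := cL.isPullback cAP cBAAB (IsCartesian.prodMap cAA cAA) O.lInv_isPullback
        (cAP.map_lift _) (cBAAB.map_lift _) (map_pathEnds ha hAP hAA) (map_compConst ha hBA hAB hAA)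
      obj := Q'
      toRInv := cR.lift (φ ≫ O.toRInv)
      toLInv := cL.lift (φ ≫ O.toLInv)
      isPullback := cQ.isPullback cR cL cAB O.isPullback (cR.map_lift _) (cL.map_lift _)
        (by
          rw [Functor.map_comp, Category.assoc, ← prodMap_pfst ηBA, ← Category.assoc, cABBA.map_lift,
            Category.assoc])
        (by
          rw [Functor.map_comp, Category.assoc, ← prodMap_psnd, ← Category.assoc, cBAAB.map_lift,
            Category.assoc]) }
  refine ⟨O', φ, cQ, ?_⟩
  intro X' X x e' g' h' H' K' e g h H K H₀' H₁' K₀' K₁' H₀ H₁ K₀ K₁ he hg hh hH hK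
  have r₁ : (Over.map f).map O'.toRInv ≫ ρ = φ ≫ O.toRInv := cR.map_lift _
  have r₂ : (Over.map f).map O'.toLInv ≫ l = φ ≫ O.toLInv := cL.map_lift _
  have r₃ : (Over.map f).map O'.rTop ≫ ηBP = ρ ≫ O.rTop := cBP.map_lift _
  have r₄ : (Over.map f).map O'.rProj ≫ prodMap ηBA ηAB = ρ ≫ O.rProj := cABBA.map_lift _
  have r₅ : (Over.map f).map O'.lTop ≫ ηAP = l ≫ O.lTop := cAP.map_lift _
  have r₆ : (Over.map f).map O'.lProj ≫ prodMap ηAB ηBA = l ≫ O.lProj := cBAAB.map_lift _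
  apply O.isPullback.hom_ext
  · rw [Category.assoc, Category.assoc, ← r₁, ← Functor.map_comp_assoc]
    simp only [ObjectOfEquivalences.lift, IsPullback.lift_fst]
    apply O.rInv_isPullback.hom_ext
    · rw [Category.assoc, Category.assoc, ← r₃, ← Functor.map_comp_assoc, IsPullback.lift_fst,
        IsPullback.lift_fst]
      exact hBP.map_curry hb x hK
    · rw [Category.assoc, Category.assoc, ← r₄, ← Functor.map_comp_assoc, IsPullback.lift_snd,
        IsPullback.lift_snd, comp_plift]
      refine (map_plift_prodMap _ _ _ _).trans ?_
      exact congrArg₂ plift (hAB.map_curry ha x he) (hBA.map_curry hb x hh)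
  · rw [Category.assoc, Category.assoc, ← r₂, ← Functor.map_comp_assoc]
    simp only [ObjectOfEquivalences.lift, IsPullback.lift_snd]
    apply O.lInv_isPullback.hom_ext
    · rw [Category.assoc, Category.assoc, ← r₅, ← Functor.map_comp_assoc, IsPullback.lift_fst,
        IsPullback.lift_fst]
      exact hAP.map_curry ha x hH
    · rw [Category.assoc, Category.assoc, ← r₆, ← Functor.map_comp_assoc, IsPullback.lift_snd,
        IsPullback.lift_snd, comp_plift]
      refine (map_plift_prodMap _ _ _ _).trans ?_
      exact congrArg₂ plift (hBA.map_curry hb x hg) (hAB.map_curry ha x he)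

end

end InternalHoms

/-! ### Base change of the canonical map to the object of equivalences -/

section Delta

variable {C : Type u} [Category.{v} C] {F : MorphismProperty C} [IsTribe F]
  {B B' S S' : C} {b : B' ⟶ B} {f : S' ⟶ S} {E : FibrantSlice F B} {E' : FibrantSlice F B'}

/-- The map `π'^* E' ⟶ π^* E` over `f` induced by a map `E' ⟶ E` over `b`. -/
noncomputable def baseChangeOver (ε : (Over.map b).obj E'.obj ⟶ E.obj) {π : S ⟶ B} {π' : S' ⟶ B'}
    (w : f ≫ π = π' ≫ b) :
    (Over.map f).obj (baseChange π' E').obj ⟶ (baseChange π E).obj :=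
  Over.homMk (pullback.lift (pullback.fst π' E'.obj.hom ≫ f) (pullback.snd π' E'.obj.hom ≫ ε.left)
    ((Category.assoc _ _ _).trans ((congrArg (_ ≫ ·) w).trans
      ((pullback.condition_assoc _).trans ((congrArg (_ ≫ ·) (Over.w ε).symm).trans
        (Category.assoc _ _ _).symm))))) (pullback.lift_fst _ _ _)

section

variable (ε : (Over.map b).obj E'.obj ⟶ E.obj) {π : S ⟶ B} {π' : S' ⟶ B'} (w : f ≫ π = π' ≫ b)

lemma baseChangeOver_fst : (baseChangeOver ε w).left ≫ pullback.fst π E.obj.hom =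
    pullback.fst π' E'.obj.hom ≫ f :=
  pullback.lift_fst _ _ _

lemma baseChangeOver_snd : (baseChangeOver ε w).left ≫ pullback.snd π E.obj.hom =
    pullback.snd π' E'.obj.hom ≫ ε.left :=
  pullback.lift_snd _ _ _

lemma baseChangeOver_isCartesian {ε : (Over.map b).obj E'.obj ⟶ E.obj} (hε : IsCartesian ε)
    (w : f ≫ π = π' ≫ b) : IsCartesian (baseChangeOver ε w) := by
  refine IsPullback.of_right (h₁₂ := pullback.snd π E.obj.hom) (h₂₂ := π) (v₁₃ := E.obj.hom) ?_
    (baseChangeOver_fst ε w) (IsPullback.of_hasPullback π E.obj.hom).flip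
  refine Eq.mp ?_ ((IsPullback.of_hasPullback π' E'.obj.hom).flip.paste_horiz hε)
  rw [w]
  exact congrArg (fun k => IsPullback k _ _ _) (baseChangeOver_snd ε w).symm

end

variable (ε : (Over.map b).obj E'.obj ⟶ E.obj) {π₁ π₂ : S ⟶ B} {s : B ⟶ S}
  {h₁ : s ≫ π₁ = 𝟙 B} {h₂ : s ≫ π₂ = 𝟙 B} {π₁' π₂' : S' ⟶ B'} {s' : B' ⟶ S'}
  {h₁' : s' ≫ π₁' = 𝟙 B'} {h₂' : s' ≫ π₂' = 𝟙 B'}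
  (w₁ : f ≫ π₁ = π₁' ≫ b) (w₂ : f ≫ π₂ = π₂' ≫ b) (ws : b ≫ s = s' ≫ f)

lemma map_idOver :
    (Over.map f).map (idOver E' π₁' π₂' s' h₁' h₂') ≫ baseChangeOver ε w₂ =
      prodMap (baseChangeOver ε w₁) (Over.homMk b ws : (Over.map f).obj (Over.mk s') ⟶ Over.mk s) ≫
        idOver E π₁ π₂ s h₁ h₂ := by
  have p₁ := congrArg CommaMorphism.left (prodMap_pfst (baseChangeOver ε w₁)
    (Over.homMk b ws : (Over.map f).obj (Over.mk s') ⟶ Over.mk s))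
  have p₂ := congrArg CommaMorphism.left (prodMap_psnd (baseChangeOver ε w₁)
    (Over.homMk b ws : (Over.map f).obj (Over.mk s') ⟶ Over.mk s))
  ext
  apply pullback.hom_ext
  · refine (Category.assoc _ _ _).trans ((congrArg (_ ≫ ·) (baseChangeOver_fst ε w₂)).trans ?_)
    refine (pullback.lift_fst_assoc _ _ _ _).trans ?_
    refine Eq.trans ?_ ((Category.assoc _ _ _).trans (congrArg (_ ≫ ·) (pullback.lift_fst _ _ _))).symm
    refine Eq.trans ?_ ((Category.assoc _ _ _).symm.trans (congrArg (· ≫ s) p₁)).symm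
    refine (Category.assoc _ _ _).trans (Eq.trans ?_ (Category.assoc _ _ _).symm)
    exact congrArg (_ ≫ ·) ws.symm
  · refine (Category.assoc _ _ _).trans ((congrArg (_ ≫ ·) (baseChangeOver_snd ε w₂)).trans ?_)
    refine (pullback.lift_snd_assoc _ _ _ _).trans ?_
    refine Eq.trans ?_ ((Category.assoc _ _ _).trans (congrArg (_ ≫ ·) (pullback.lift_snd _ _ _))).symm
    refine Eq.trans ?_ ((Category.assoc _ _ _).symm.trans (congrArg (· ≫ pullback.snd _ _) p₂)).symm
    refine (Category.assoc _ _ _).trans (Eq.trans ?_ (Category.assoc _ _ _).symm)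
    exact congrArg (_ ≫ ·) (baseChangeOver_snd ε w₁).symm

include w₁ w₂ in
-- The defining data of `delta`, namely identities and constant homotopies, lie over each other, so
-- `ObjectOfEquivalences.exists_pull` applies. The resulting square of `delta` maps is only asserted
-- to commute; it is `φ` that is cartesian.
theorem exists_delta_compatible (hf : F f) {ε : (Over.map b).obj E'.obj ⟶ E.obj} (hε : IsCartesian ε)
    {P₁ : PathObject (sliceFib F S) (baseChange π₁ E)}
    {P₂ : PathObject (sliceFib F S) (baseChange π₂ E)} (O : ObjectOfEquivalences P₁ P₂) :
    ∃ (P₁' : PathObject (sliceFib F S') (baseChange π₁' E'))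
      (P₂' : PathObject (sliceFib F S') (baseChange π₂' E')) (O' : ObjectOfEquivalences P₁' P₂')
      (φ : (Over.map f).obj O'.obj ⟶ O.obj), IsCartesian φ ∧
      (Over.map f).map (delta E' π₁' π₂' s' h₁' h₂' O') ≫ φ =
        (Over.homMk b ws : (Over.map f).obj (Over.mk s') ⟶ Over.mk s) ≫
          delta E π₁ π₂ s h₁ h₂ O := by
  obtain ⟨O', φ, hφ, h⟩ := O.exists_pull hf (baseChangeOver_isCartesian hε w₁)
    (baseChangeOver_isCartesian hε w₂)
  refine ⟨_, _, O', φ, hφ, h _ _ _ _ _ _ _ _ _ _ _ _ _ _ _ _ _ _ _ (map_idOver ε w₁ w₂ ws)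
    (map_idOver ε w₂ w₁ ws) (map_idOver ε w₂ w₁ ws) ?_ ?_⟩
  · rw [Functor.map_comp]
    refine (Category.assoc _ _ _).trans ((congrArg (_ ≫ ·) (P₁.pull_i _)).trans ?_)
    rw [← Category.assoc, ← Category.assoc, prodMap_psnd]
  · rw [Functor.map_comp]
    refine (Category.assoc _ _ _).trans ((congrArg (_ ≫ ·) (P₂.pull_i _)).trans ?_)
    rw [← Category.assoc, ← Category.assoc, prodMap_psnd]

end Delta

/-! ### Base change of dependent products -/

section DependentProducts

variable {C : Type u} [Category.{v} C] {F : MorphismProperty C}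

section

variable [IsTribe F] {S S' : C} {f : S' ⟶ S} {A : FibrantSlice F S} {A' : FibrantSlice F S'}

/-- The canonical map between the pullbacks of an object over `S'` to `A'` and to `A`. -/
noncomputable def pullbackComparison (a : (Over.map f).obj A'.obj ⟶ A.obj) (T : Over S') :
    (Over.map (show A'.obj.left ⟶ A.obj.left from a.left)).obj ((Over.pullback A'.obj.hom).obj T) ⟶
      (Over.pullback A.obj.hom).obj ((Over.map f).obj T) :=
  Over.homMk (prodMap a (𝟙 ((Over.map f).obj T))).left
    (congrArg CommaMorphism.left (prodMap_psnd a (𝟙 ((Over.map f).obj T))))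

lemma pullbackComparison_naturality (a : (Over.map f).obj A'.obj ⟶ A.obj) {T T' : Over S'}
    (g : T ⟶ T') :
    (Over.map (show A'.obj.left ⟶ A.obj.left from a.left)).map ((Over.pullback A'.obj.hom).map g) ≫
      pullbackComparison a T' =
    pullbackComparison a T ≫ (Over.pullback A.obj.hom).map ((Over.map f).map g) := by
  have h : (Over.map f).map ((prodFunctor A').map g) ≫ prodMap a (𝟙 _) =
      prodMap a (𝟙 _) ≫ (prodFunctor A).map ((Over.map f).map g) := by
    rw [map_prodMap, prodMap_comp, Category.comp_id, Category.id_comp]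
  have h' := congrArg CommaMorphism.left h
  exact Over.OverMorphism.ext h'

lemma IsCartesian.isIso_pullbackComparison {a : (Over.map f).obj A'.obj ⟶ A.obj}
    (ha : IsCartesian a) (T : Over S') : IsIso (pullbackComparison a T) := by
  have := ha.isIso_prodMap T
  have : IsIso ((Over.forget _).map (pullbackComparison a T)) :=
    inferInstanceAs (IsIso ((Over.forget S).map (Tribes.prodMap a (𝟙 ((Over.map f).obj T)))))
  exact isIso_of_reflects_iso _ (Over.forget _)

/-- The base change of a dependent product. -/
noncomputable def DependentProduct.pull {Z : FibrantSlice F A.obj.left}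
    {Z' : FibrantSlice F A'.obj.left} (W : DependentProduct A Z)
    {a : (Over.map f).obj A'.obj ⟶ A.obj} (ha : IsCartesian a)
    {z : (Over.map (show A'.obj.left ⟶ A.obj.left from a.left)).obj Z'.obj ⟶ Z.obj}
    (hz : IsCartesian z) : DependentProduct A' Z' where
  obj := baseChange f W.obj
  repr :=
    -- Beck–Chevalley: the pullback of `T` to `A'` and the pullback of `T`, seen over `S`, to `A`
    -- coincide, so both transposes describe the same maps.
    { homEquiv := fun {T} =>
        { toFun := fun t => hz.lift (pullbackComparison a T ≫
            W.repr.homEquiv ((Over.map f).map t ≫ baseChangeProj f W.obj))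
          invFun := fun (k : (Over.pullback A'.obj.hom).obj T ⟶ Z'.obj) =>
            (baseChangeProj_isCartesian f W.obj).lift (W.repr.homEquiv.symm
              (haveI := ha.isIso_pullbackComparison T; inv (pullbackComparison a T) ≫ (Over.map _).map k ≫ z))
          left_inv := fun t => by
            have := ha.isIso_pullbackComparison T
            apply (baseChangeProj_isCartesian f W.obj).hom_ext
            rw [IsCartesian.map_lift]
            refine (congrArg (fun k => W.repr.homEquiv.symm (inv (pullbackComparison a T) ≫ k))
              (hz.map_lift _)).trans ?_
            rw [Equiv.symm_apply_eq]
            exact IsIso.inv_hom_id_assoc _ _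
          right_inv := fun k => by
            have := ha.isIso_pullbackComparison T
            apply hz.hom_ext
            refine (hz.map_lift _).trans ?_
            rw [IsCartesian.map_lift, Equiv.apply_symm_apply]
            exact IsIso.hom_inv_id_assoc _ _ }
      homEquiv_comp := fun {T T'} g t => by
        apply hz.hom_ext
        refine (hz.map_lift _).trans ?_
        have e : (Over.map _).map ((Over.pullback A'.obj.hom).map g ≫ hz.lift (pullbackComparison a T' ≫
            W.repr.homEquiv ((Over.map f).map t ≫ baseChangeProj f W.obj))) ≫ z =
            pullbackComparison a T ≫
              W.repr.homEquiv ((Over.map f).map (g ≫ t) ≫ baseChangeProj f W.obj) := by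
          rw [Functor.map_comp, Category.assoc, hz.map_lift, ← Category.assoc,
            pullbackComparison_naturality, Functor.map_comp, Category.assoc, Category.assoc,
            W.repr.homEquiv_comp ((Over.map f).map g)]
          rfl
        exact e.symm }

/-- The dependent product of the identity. -/
noncomputable def DependentProduct.ofId (A : FibrantSlice F S) :
    DependentProduct A (FibrantSlice.of (𝟙 A.obj.left) (F.id_mem _)) where
  obj := FibrantSlice.of (𝟙 S) (F.id_mem _)
  repr :=
    { homEquiv := fun {_} =>
        { toFun := fun _ => Over.mkIdTerminal.from _
          invFun := fun _ => Over.mkIdTerminal.from _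
          left_inv := fun _ => Over.mkIdTerminal.hom_ext _ _
          right_inv := fun _ => Over.mkIdTerminal.hom_ext _ _ }
      homEquiv_comp := fun _ _ => Over.mkIdTerminal.hom_ext _ _ }

end

/-- Dependent products of fibrewise contractible fibrations are fibrewise contractible. -/
lemma DependentProduct.exists_contraction [IsPiTribe F] {Y : C} {A : FibrantSlice F Y}
    {Z : FibrantSlice F A.obj.left} (W : DependentProduct A Z) {s : A.obj.left ⟶ Z.obj.left}
    (hs : s ≫ Z.obj.hom = 𝟙 _) (H : HomotopicOver F Z.obj.hom (Z.obj.hom ≫ s) (𝟙 _)) :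
    ∃ r : Y ⟶ W.obj.obj.left, r ≫ W.obj.obj.hom = 𝟙 _ ∧
      HomotopicOver F W.obj.obj.hom (W.obj.obj.hom ≫ r) (𝟙 _) := by
  -- Contractibility says that the map to the terminal object of the fibrant slice is a homotopy
  -- equivalence, and the dependent product of the terminal object is terminal.
  let g : Z ⟶ FibrantSlice.of (𝟙 A.obj.left) (F.id_mem _) :=
    FibrantSlice.homMk Z.obj.hom (Category.comp_id _)
  have hg : IsHomotopyEquiv (sliceFib F A.obj.left) g := by
    refine ⟨FibrantSlice.homMk s hs, (homotopic_sliceFib_iff _ _).2 H,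
      (homotopic_sliceFib_iff _ _).2 (HomotopicOver.of_eq hs)⟩
  obtain ⟨k, hk, -⟩ := IsPiTribe.map_isHomotopyEquiv W (DependentProduct.ofId A) g hg
  refine ⟨k.hom.left, FibrantSlice.w k, ?_⟩
  have e : (W.map (DependentProduct.ofId A) g).hom.left = W.obj.obj.hom :=
    (Category.comp_id _).symm.trans (FibrantSlice.w (W.map (DependentProduct.ofId A) g))
  have H' : HomotopicOver F W.obj.obj.hom ((W.map (DependentProduct.ofId A) g).hom.left ≫ k.hom.left)
      (𝟙 _) := (homotopic_sliceFib_iff _ _).1 hk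
  rwa [e] at H'

end DependentProducts

/-! ### Homotopy monic fibrations -/

section HomotopyMono

variable {C : Type u} [Category.{v} C] {F : MorphismProperty C}

namespace RelativePathObject

variable {X Y : C} {f : X ⟶ Y} (R : RelativePathObject F f)

lemma homotopicOver_d₀_i [HasTerminal C] :
    HomotopicOver F (terminal.from R.obj) ((R.d ≫ R.π₁) ≫ R.i) (𝟙 _) :=
  .of_agree R.anodyne_i (by
    have h := R.i_d₀
    rw [Category.comp_id, ← Category.assoc, h, Category.id_comp]) (Subsingleton.elim _ _)

variable [IsTribe F]

/-- A section of a path object is a homotopy inverse over the base. -/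
lemma homotopicOver_d_section {s : R.sq ⟶ R.obj} (hs : s ≫ R.d = 𝟙 _) :
    HomotopicOver F R.d (R.d ≫ s) (𝟙 _) := by
  have := IsTribe.hasTerminal (F := F)
  have hf := IsTribe.fibrant (F := F)
  refine homotopicOver_section R.fib_d (hf R.sq) hs ?_
  rw [Subsingleton.elim (R.d ≫ terminal.from R.sq) (terminal.from R.obj)]
  -- Put `c = (R.d ≫ R.π₁) ≫ R.i`, which is homotopic to the identity. Writing composites in diagram
  -- order, `ds ∼ cds ∼ cdsc = c ∼ 1`, where the equality uses that `s` is a section of `d`. This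
  -- homotopy is absolute; `homotopicOver_section` has reduced the claim over `R.sq` to it.
  have J := R.homotopicOver_d₀_i
  have h₁ := J.symm.postcomp_terminal (R.d ≫ s)
  have h₂ := J.symm.precomp (((R.d ≫ R.π₁) ≫ R.i) ≫ R.d ≫ s)
  have e : (((R.d ≫ R.π₁) ≫ R.i) ≫ R.d ≫ s) ≫ (R.d ≫ R.π₁) ≫ R.i = (R.d ≫ R.π₁) ≫ R.i := by
    have h := R.i_d₀
    simp only [Category.assoc]
    rw [reassoc_of% hs, reassoc_of% h]
  rw [e] at h₂
  rw [Category.id_comp] at h₁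
  rw [Category.comp_id] at h₂
  exact (h₁.trans (hf _) h₂).trans (hf _) J

/-- As `f` is a fibration, the comparison map is just the diagonal `R.i ≫ R.d`, with inverse `R.π₁`.
Contracting the path `s (x, y)` to its start deforms `(x, y)` to `(x, x)`. -/
lemma isHomotopyMono_of_section (hf : F f) {s : R.sq ⟶ R.obj} (hs : s ≫ R.d = 𝟙 _) :
    IsHomotopyMono F f := by
  have := IsTribe.hasTerminal (F := F)
  refine ⟨rfl, X, 𝟙 X, f, MorphismProperty.llp_of_isIso F _, hf, Category.id_comp _, R.sq, R.π₁, R.π₂,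
    R.i ≫ R.d, R.isPullback, ?_, ?_, R.π₁, ?_, ?_⟩
  · rw [Category.assoc, R.i_d₀]
  · rw [Category.assoc, R.i_d₁, Category.comp_id]
  · rw [homotopic_iff, Category.assoc, R.i_d₀]
    exact .refl _ _
  · rw [homotopic_iff]
    have h := (R.homotopicOver_d₀_i.postcomp_terminal R.d).precomp s
    simp only [Category.assoc, Category.id_comp] at h
    rwa [reassoc_of% hs, hs] at h

end RelativePathObject

variable [IsTribe F]

/-- Lifting against `f` retracts the factorisation in the homotopy pullback, so `R.sq` becomes a
retract of `Q`. The homotopy inverse of `k` then gives a map `R.sq ⟶ R.obj` that is a section of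
`R.d` up to homotopy, and lifting along the fibration `R.d` makes it strict. -/
lemma IsHomotopyMono.exists_section {X Y : C} {f : X ⟶ Y} (hf : F f) (hm : IsHomotopyMono F f)
    (R : RelativePathObject F f) : ∃ s : R.sq ⟶ R.obj, s ≫ R.d = 𝟙 _ := by
  have := IsTribe.hasTerminal (F := F)
  obtain ⟨-, Z, i, q, hi, hq, w, Q, a, b, k, hQ, hka, hkb, g, -, hg⟩ := hm
  rw [homotopic_iff] at hg
  obtain ⟨r, hr, hr'⟩ := exists_lift_of_llp hi hf (𝟙 X) q (by rw [Category.id_comp, w])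
  let u : R.sq ⟶ Q := hQ.lift R.π₁ (R.π₂ ≫ i) (by rw [R.isPullback.w, Category.assoc, w])
  let ρ : Q ⟶ R.sq := R.isPullback.lift a (b ≫ r) (by rw [Category.assoc, hr', hQ.w])
  have hu₁ : u ≫ a = R.π₁ := hQ.lift_fst _ _ _
  have hu₂ : u ≫ b = R.π₂ ≫ i := hQ.lift_snd _ _ _
  have hρ₁ : ρ ≫ R.π₁ = a := R.isPullback.lift_fst _ _ _
  have hρ₂ : ρ ≫ R.π₂ = b ≫ r := R.isPullback.lift_snd _ _ _
  have huρ : u ≫ ρ = 𝟙 _ := by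
    apply R.isPullback.hom_ext
    · rw [Category.assoc, hρ₁, hu₁, Category.id_comp]
    · rw [Category.assoc, hρ₂, reassoc_of% hu₂, hr, Category.id_comp, Category.comp_id]
  have hk : R.i ≫ R.d = k ≫ ρ := by
    apply R.isPullback.hom_ext
    · rw [Category.assoc, R.i_d₀, Category.assoc, hρ₁, hka]
    · rw [Category.assoc, R.i_d₁, Category.assoc, hρ₂, reassoc_of% hkb, hr]
  have H := (hg.postcomp_terminal ρ).precomp u
  rw [Category.id_comp, huρ] at H
  obtain ⟨s, hs, -⟩ := H.lift_fibration R.fib_d (IsTribe.fibrant (F := F) _) (u ≫ g ≫ R.i) (by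
    simp only [Category.assoc, hk])
  exact ⟨s, hs⟩

/-- Homotopies over a fibration are stable under base change. -/
lemma HomotopicOver.baseChange {B B' D D' T : C} {b : B' ⟶ B} (hb : F b) {x y : T ⟶ B'}
    (H : HomotopicOver F b x y) {c : D ⟶ B} {π : D' ⟶ B'} {π' : D' ⟶ D} (hP : IsPullback π π' b c)
    {x' y' : T ⟶ D'} (hx : x' ≫ π = x) (hy : y' ≫ π = y) (h : x' ≫ π' = y' ≫ π') :
    HomotopicOver F π' x' y' := by
  obtain ⟨R⟩ := RelativePathObject.nonempty (F := F) hb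
  obtain ⟨t, ht₀, ht₁⟩ := H.exists_lift R
  have hz : F (R.d ≫ R.π₁ ≫ b) := by
    rw [← Category.assoc]; exact F.comp_mem _ _ (R.fib_d₀ hb) hb
  have hd₀ := R.i_d₀
  have hd₁ := R.i_d₁
  have hw : R.d ≫ R.π₁ ≫ b = R.d ≫ R.π₂ ≫ b := by rw [R.isPullback.w]
  have := IsTribe.hasPullback c _ hz
  have hZ := (IsPullback.of_hasPullback c (R.d ≫ R.π₁ ≫ b)).flip
  let i' : D' ⟶ pullback c (R.d ≫ R.π₁ ≫ b) :=
    hZ.lift (π ≫ R.i) π' (by rw [Category.assoc, reassoc_of% hd₀, hP.w])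
  have hi' : F.llp i' := anodyne_baseChange R.anodyne_i hb hz (by rw [reassoc_of% hd₀]) hP hZ
    (hZ.lift_fst _ _ _) (hZ.lift_snd _ _ _)
  let t' : T ⟶ pullback c (R.d ≫ R.π₁ ≫ b) :=
    hZ.lift t (x' ≫ π') (by rw [reassoc_of% ht₀, ← hx, Category.assoc, hP.w, Category.assoc])
  let d₀ : pullback c (R.d ≫ R.π₁ ≫ b) ⟶ D' := hP.lift (pullback.snd _ _ ≫ R.d ≫ R.π₁)
    (pullback.fst _ _) (by simp only [Category.assoc, hZ.w])
  let d₁ : pullback c (R.d ≫ R.π₁ ≫ b) ⟶ D' := hP.lift (pullback.snd _ _ ≫ R.d ≫ R.π₂)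
    (pullback.fst _ _) (by simp only [Category.assoc, ← hw, hZ.w])
  refine ⟨D', _, i', d₀, d₁, t', hi', ?_, ?_, ?_, ?_⟩
  · apply hP.hom_ext
    · simp only [i', d₀, d₁, Category.assoc, IsPullback.lift_fst, IsPullback.lift_fst_assoc, hd₀, hd₁]
    · simp only [d₀, d₁, Category.assoc, IsPullback.lift_snd]
  · simp only [d₀, d₁, IsPullback.lift_snd]
  · apply hP.hom_ext
    · simp only [t', d₀, Category.assoc, IsPullback.lift_fst, IsPullback.lift_fst_assoc, ht₀, hx]
    · simp only [t', d₀, Category.assoc, IsPullback.lift_snd]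
  · apply hP.hom_ext
    · simp only [t', d₁, Category.assoc, IsPullback.lift_fst, IsPullback.lift_fst_assoc, ht₁, hy]
    · simp only [t', d₁, Category.assoc, IsPullback.lift_snd, h]

end HomotopyMono

/-! ### Univalence is stable under base change along homotopy monic fibrations -/

section UnivalentBaseChange

variable {C : Type u} [Category.{v} C] {F : MorphismProperty C}

section

variable [IsTribe F] [HasTerminal C] {B B' : C} {b : B' ⟶ B}

/-- Changing one coordinate in a fibrewise proposition does not change a map up to homotopy. -/
lemma homotopicOver_of_coordinate (hb : F b)
    (hprop : ∀ {T : C} (x y : T ⟶ B'), x ≫ b = y ≫ b → HomotopicOver F b x y)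
    {T Q : C} {x y : T ⟶ Q} {x₁ y₁ : T ⟶ B'} (h : x₁ ≫ b = y₁ ≫ b)
    (H : ∀ {D : C} (π' : D ⟶ T) (π : D ⟶ B'), π' ≫ x₁ ≫ b = π ≫ b → ∃ m : D ⟶ Q,
      ∀ r : T ⟶ D, r ≫ π' = 𝟙 T → (r ≫ π = x₁ → r ≫ m = x) ∧ (r ≫ π = y₁ → r ≫ m = y)) :
    HomotopicOver F (terminal.from Q) x y := by
  -- This pullback is the generic way to replace the coordinate `x₁` by another point of the same
  -- fibre. The maps `x` and `y` are the restrictions of the single map `m` along two sections,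
  -- which are homotopic over `T`.
  have := IsTribe.hasPullback (x₁ ≫ b) b hb
  obtain ⟨m, hm⟩ := H (pullback.fst (x₁ ≫ b) b) (pullback.snd _ _) pullback.condition
  have e₁ : pullback.lift (𝟙 T) x₁ (Category.id_comp _) ≫ m = x :=
    (hm _ (pullback.lift_fst _ _ _)).1 (pullback.lift_snd _ _ _)
  have e₂ : pullback.lift (𝟙 T) y₁ ((Category.id_comp _).trans h) ≫ m = y :=
    (hm _ (pullback.lift_fst _ _ _)).2 (pullback.lift_snd _ _ _)
  rw [← e₁, ← e₂]
  exact (((hprop x₁ y₁ h).baseChange hb (IsPullback.of_hasPullback (x₁ ≫ b) b).flip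
    (pullback.lift_snd _ _ _) (pullback.lift_snd _ _ _)
    (by rw [pullback.lift_fst, pullback.lift_fst])).toTerminal).postcomp_terminal m

/-- A map to `Q'` is a map to `Q` with lifts of its two coordinates from `B` to `B'`. The
coordinates of `x` are changed one at a time, passing through the map `z` with first coordinate from
`y` and second from `x`. -/
lemma homotopicOver_of_isPullback_prodMap [HasBinaryProduct B B] [HasBinaryProduct B' B'] (hb : F b)
    (hprop : ∀ {T : C} (x y : T ⟶ B'), x ≫ b = y ≫ b → HomotopicOver F b x y)
    {Q Q' T : C} {φ : Q' ⟶ Q} {h' : Q' ⟶ B' ⨯ B'} {h : Q ⟶ B ⨯ B}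
    (hφ : IsPullback φ h' h (prod.map b b)) {x y : T ⟶ Q'} (hxy : x ≫ φ = y ≫ φ) :
    HomotopicOver F (terminal.from Q') x y := by
  have k₁ : (h' ≫ prod.fst) ≫ b = φ ≫ h ≫ prod.fst := by
    rw [hφ.w_assoc, prod.map_fst, Category.assoc]
  have k₂ : (h' ≫ prod.snd) ≫ b = φ ≫ h ≫ prod.snd := by
    rw [hφ.w_assoc, prod.map_snd, Category.assoc]
  have w₁ : (x ≫ h' ≫ prod.fst) ≫ b = (y ≫ h' ≫ prod.fst) ≫ b := by
    rw [Category.assoc, k₁, reassoc_of% hxy, Category.assoc, k₁]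
  have w₂ : (x ≫ h' ≫ prod.snd) ≫ b = (y ≫ h' ≫ prod.snd) ≫ b := by
    rw [Category.assoc, k₂, reassoc_of% hxy, Category.assoc, k₂]
  have key : ∀ {D : C} (q : D ⟶ Q) (m₁ m₂ : D ⟶ B'), m₁ ≫ b = q ≫ h ≫ prod.fst →
      m₂ ≫ b = q ≫ h ≫ prod.snd → ∃ m : D ⟶ Q', m ≫ φ = q ∧ m ≫ h' ≫ prod.fst = m₁ ∧
        m ≫ h' ≫ prod.snd = m₂ := by
    intro D q m₁ m₂ e₁ e₂
    refine ⟨hφ.lift q (prod.lift m₁ m₂) ?_, hφ.lift_fst _ _ _, ?_, ?_⟩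
    · ext
      · rw [Category.assoc, ← e₁, prod.lift_map, prod.lift_fst]
      · rw [Category.assoc, ← e₂, prod.lift_map, prod.lift_snd]
    · rw [IsPullback.lift_snd_assoc, prod.lift_fst]
    · rw [IsPullback.lift_snd_assoc, prod.lift_snd]
  have ext' : ∀ {D : C} {u v : D ⟶ Q'}, u ≫ φ = v ≫ φ →
      u ≫ h' ≫ prod.fst = v ≫ h' ≫ prod.fst → u ≫ h' ≫ prod.snd = v ≫ h' ≫ prod.snd → u = v := by
    intro D u v e e₁ e₂
    apply hφ.hom_ext e
    ext
    · simpa only [Category.assoc] using e₁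
    · simpa only [Category.assoc] using e₂
  obtain ⟨z, hz, hz₁, hz₂⟩ := key (x ≫ φ) (y ≫ h' ≫ prod.fst) (x ≫ h' ≫ prod.snd)
    (by rw [← w₁, Category.assoc, k₁, Category.assoc]) (by rw [Category.assoc, k₂, Category.assoc])
  refine HomotopicOver.trans (IsTribe.fibrant (F := F) _) (h := z) ?_ ?_
  · refine homotopicOver_of_coordinate hb hprop w₁ fun π' π e => ?_
    obtain ⟨m, hm, hm₁, hm₂⟩ := key (π' ≫ x ≫ φ) π (π' ≫ x ≫ h' ≫ prod.snd)
      (by rw [← e, Category.assoc, k₁]; simp only [Category.assoc])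
      (by rw [Category.assoc, Category.assoc, k₂]; simp only [Category.assoc])
    refine ⟨m, fun r hr => ⟨fun hr₁ => ext' ?_ ?_ ?_, fun hr₁ => ext' ?_ ?_ ?_⟩⟩
    · rw [Category.assoc, hm, reassoc_of% hr]
    · rw [Category.assoc, hm₁, hr₁]
    · rw [Category.assoc, hm₂, reassoc_of% hr]
    · rw [Category.assoc, hm, reassoc_of% hr, hz]
    · rw [Category.assoc, hm₁, hr₁, hz₁]
    · rw [Category.assoc, hm₂, reassoc_of% hr, hz₂]
  · refine homotopicOver_of_coordinate hb hprop w₂ fun π' π e => ?_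
    obtain ⟨m, hm, hm₁, hm₂⟩ := key (π' ≫ x ≫ φ) (π' ≫ y ≫ h' ≫ prod.fst) π
      (by rw [Category.assoc, ← w₁]; simp only [Category.assoc] at k₁ ⊢; rw [k₁])
      (by rw [← e, Category.assoc, k₂]; simp only [Category.assoc])
    refine ⟨m, fun r hr => ⟨fun hr₁ => ext' ?_ ?_ ?_, fun hr₁ => ext' ?_ ?_ ?_⟩⟩
    · rw [Category.assoc, hm, reassoc_of% hr, hz]
    · rw [Category.assoc, hm₁, reassoc_of% hr, hz₁]
    · rw [Category.assoc, hm₂, hr₁, hz₂]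
    · rw [Category.assoc, hm, reassoc_of% hr, hxy]
    · rw [Category.assoc, hm₁, reassoc_of% hr]
    · rw [Category.assoc, hm₂, hr₁]

lemma fib_prodMap [HasBinaryProduct B B] [HasBinaryProduct B' B'] (hb : F b) :
    F (prod.map b b) := by
  have := IsTribe.hasBinaryProduct F B' B
  have e : prod.map b b = prod.map (𝟙 B') b ≫ prod.map b (𝟙 B) := by simp
  rw [e]
  refine F.comp_mem _ _ ?_ ?_
  · refine MorphismProperty.of_isPullback (f' := prod.snd) (f := prod.snd) (g := b) ?_ hb
    refine IsPullback.of_bot (v₂₁ := prod.fst) (v₂₂ := terminal.from B) (h₃₁ := terminal.from B')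
      ?_ (by simp) (IsPullback.of_hasBinaryProduct' B' B).flip
    rw [prod.map_fst, Category.comp_id, Subsingleton.elim (b ≫ terminal.from B) (terminal.from B')]
    exact (IsPullback.of_hasBinaryProduct' B' B').flip
  · refine MorphismProperty.of_isPullback (f' := prod.fst) (f := prod.fst) (g := b) ?_ hb
    refine IsPullback.of_bot (v₂₁ := prod.snd) (v₂₂ := terminal.from B) (h₃₁ := terminal.from B)
      ?_ (by simp) (IsPullback.of_hasBinaryProduct' B B)
    rw [prod.map_snd, Category.comp_id, Subsingleton.elim (b ≫ terminal.from B) (terminal.from B')]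
    exact IsPullback.of_hasBinaryProduct' B' B

end

variable [IsPiTribe F]

theorem IsUnivalent.of_isPullback {E B E' B' : C} {p : E ⟶ B} (hu : IsUnivalent F p) {b : B' ⟶ B}
    (hb : F b) (hprop : ∀ {T : C} (x y : T ⟶ B'), x ≫ b = y ≫ b → HomotopicOver F b x y)
    {q : E' ⟶ E} {p' : E' ⟶ B'} (hpb : IsPullback q p' p b) : IsUnivalent F p' := by
  have := IsTribe.hasTerminal (F := F)
  have := IsTribe.hasBinaryProduct F B B
  have := IsTribe.hasBinaryProduct F B' B'
  obtain ⟨hp, P₁, P₂, O, g, -, hg⟩ := hu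
  have hp' : F p' := MorphismProperty.of_isPullback hpb hp
  obtain ⟨P₁', P₂', O', φ, hφ, hδ⟩ := exists_delta_compatible (F := F) (f := prod.map b b) (b := b)
    (E := FibrantSlice.of p hp) (E' := FibrantSlice.of p' hp')
    (π₁' := prod.fst) (π₂' := prod.snd) (s := diag B) (s' := diag B')
    (h₁ := prod.lift_fst _ _) (h₂ := prod.lift_snd _ _)
    (h₁' := prod.lift_fst _ _) (h₂' := prod.lift_snd _ _)
    (prod.map_fst b b) (prod.map_snd b b) (by simp) (fib_prodMap hb)
    (ε := Over.homMk q hpb.w) hpb O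
  -- The inverse is the first projection; one composite is strictly the identity because `delta`
  -- lies over the diagonal.
  refine ⟨hp', P₁', P₂', O', O'.obj.hom ≫ prod.fst, ?_, ?_⟩
  · rw [homotopic_iff]
    refine .of_eq ?_
    exact (Over.w_assoc _ _).trans (prod.lift_fst (𝟙 B') (𝟙 B'))
  rw [homotopic_iff] at hg ⊢
  set δ := (delta (FibrantSlice.of p hp) prod.fst prod.snd (diag B) (prod.lift_fst _ _)
    (prod.lift_snd _ _) O).left with hδ_def
  set δ' := (delta (FibrantSlice.of p' hp') prod.fst prod.snd (diag B') (prod.lift_fst _ _)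
    (prod.lift_snd _ _) O').left with hδ'_def
  have hφ' : IsPullback (show O'.obj.left ⟶ O.obj.left from φ.left) O'.obj.hom O.obj.hom
    (prod.map b b) := hφ
  have hδφ : δ' ≫ (show O'.obj.left ⟶ O.obj.left from φ.left) = b ≫ δ :=
    congrArg CommaMorphism.left hδ
  have hδe : δ ≫ O.obj.hom ≫ prod.fst = 𝟙 B := (Over.w_assoc _ _).trans (prod.lift_fst (𝟙 B) (𝟙 B))
  generalize (show O'.obj.left ⟶ O.obj.left from φ.left) = ψ at hφ' hδφ
  -- The first projection is a strict retraction of `δ`, so it can replace the homotopy inverse `g`.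
  have H₁ : HomotopicOver F (terminal.from _) ((O.obj.hom ≫ prod.fst) ≫ δ) (𝟙 O.obj.left) := by
    have h := hg.postcomp_terminal ((O.obj.hom ≫ prod.fst) ≫ δ)
    have e : (g ≫ δ) ≫ (O.obj.hom ≫ prod.fst) ≫ δ = g ≫ δ := by
      rw [Category.assoc]
      exact congrArg (g ≫ ·) ((Category.assoc _ _ _).symm.trans
        ((congrArg (· ≫ δ) hδe).trans (Category.id_comp _)))
    rw [e, Category.id_comp] at h
    exact h.symm.trans (IsTribe.fibrant (F := F) _) hg
  have H₂ := H₁.precomp ψ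
  rw [Category.comp_id] at H₂
  have hψ : F ψ := MorphismProperty.of_isPullback hφ'.flip (fib_prodMap hb)
  -- After `ψ`, projecting and applying `δ'` becomes homotopic to `ψ` itself. Lifting this homotopy
  -- through the fibration `ψ` ends at a map `l` with `l ≫ ψ = ψ`, and the propositional fibres give
  -- `l ∼ 𝟙`.
  obtain ⟨l, hl, H₃⟩ := H₂.lift_fibration hψ (IsTribe.fibrant (F := F) _)
    ((O'.obj.hom ≫ prod.fst) ≫ δ') (by
      rw [Category.assoc, hδφ, Category.assoc, ← prod.map_fst_assoc b b, ← hφ'.w_assoc]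
      simp only [Category.assoc])
  rw [Subsingleton.elim (ψ ≫ terminal.from _) (terminal.from _)] at H₃
  exact H₃.trans (IsTribe.fibrant (F := F) _)
    (homotopicOver_of_isPullback_prodMap hb hprop hφ' (hl.trans (Category.id_comp _).symm))

end UnivalentBaseChange

/-! ### The universal homotopy monic pullback of a fibration -/

section Classifier

variable {C : Type u} [Category.{v} C] {F : MorphismProperty C}

section

variable [IsTribe F] {E B : C} {p : E ⟶ B} {hp : F p}
  (P : PathObject (sliceFib F B) (FibrantSlice.of p hp))

/-- The base change of a path object of `p` to a path object of a pullback `p'` of `p`. -/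
noncomputable def PathObject.pullAlong {E' B' : C} {q : E' ⟶ E} {p' : E' ⟶ B'} {χ : B' ⟶ B}
    (h : IsPullback q p' p χ) :
    PathObject (sliceFib F B') (FibrantSlice.of p' (MorphismProperty.of_isPullback h hp)) :=
  P.pull (A' := FibrantSlice.of p' (MorphismProperty.of_isPullback h hp))
    (show IsCartesian (Over.homMk q h.w : (Over.map χ).obj (Over.mk p') ⟶ Over.mk p) from h)

lemma PathObject.pullAlong_d {E' B' : C} {q : E' ⟶ E} {p' : E' ⟶ B'} {χ : B' ⟶ B}
    (h : IsPullback q p' p χ) :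
    (Over.map χ).map (P.pullAlong h).d.hom ≫ baseChangeProj χ P.sq =
      baseChangeProj χ P.obj ≫ P.d.hom :=
  P.pull_d _

variable (Ω : DependentProduct P.sq (FibrantSlice.of P.d.hom.left P.fib_d))

/-- The universal path object of fibres has a section. -/
lemma DependentProduct.exists_section {E' : C} {q : E' ⟶ E} {p' : E' ⟶ Ω.obj.obj.left}
    (h : IsPullback q p' p Ω.obj.obj.hom) :
    ∃ s : (P.pullAlong h).toRelative.sq ⟶ (P.pullAlong h).toRelative.obj,
      s ≫ (P.pullAlong h).toRelative.d = 𝟙 _ := by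
  -- The transpose of the identity of `Ω` chooses a path between any two points of a fibre. Paired
  -- with the projection to `Ω`, it becomes the section.
  let m : (Over.pullback P.sq.obj.hom).obj Ω.obj.obj ⟶ Over.mk P.d.hom.left :=
    Ω.repr.homEquiv (𝟙 _)
  have hm : m.left ≫ P.d.hom.left = pullback.snd Ω.obj.obj.hom P.sq.obj.hom := Over.w m
  have hsq : IsPullback (pullback.snd Ω.obj.obj.hom P.sq.obj.hom) (P.pullAlong h).sq.obj.hom
    P.sq.obj.hom Ω.obj.obj.hom := baseChangeProj_isCartesian _ P.sq
  have hobj : IsPullback (pullback.snd Ω.obj.obj.hom P.obj.obj.hom) (P.pullAlong h).obj.obj.hom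
    P.obj.obj.hom Ω.obj.obj.hom := baseChangeProj_isCartesian _ P.obj
  have hd : (P.pullAlong h).d.hom.left ≫ pullback.snd Ω.obj.obj.hom P.sq.obj.hom =
      pullback.snd Ω.obj.obj.hom P.obj.obj.hom ≫ P.d.hom.left :=
    congrArg CommaMorphism.left (P.pullAlong_d h)
  have w : m.left ≫ P.obj.obj.hom = (P.pullAlong h).sq.obj.hom ≫ Ω.obj.obj.hom := by
    rw [← FibrantSlice.w P.d]
    refine (Category.assoc _ _ _).symm.trans ((congrArg (· ≫ _) hm).trans hsq.w)
  let s : (P.pullAlong h).sq.obj.left ⟶ (P.pullAlong h).obj.obj.left := hobj.lift m.left _ w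
  refine ⟨s, hsq.hom_ext ?_ ?_⟩
  · refine (Category.assoc _ _ _).trans ((congrArg (s ≫ ·) hd).trans ?_)
    refine (hobj.lift_fst_assoc _ _ _ _).trans (hm.trans (Category.id_comp _).symm)
  · refine (Category.assoc _ _ _).trans ((congrArg (s ≫ ·) (FibrantSlice.w _)).trans ?_)
    exact (hobj.lift_snd _ _ _).trans (Category.id_comp _).symm

/-- A pullback of `p` whose path object has a section is classified by the dependent product of the
path object of `p`. -/
lemma DependentProduct.exists_classifyingMap {E' X : C} {q : E' ⟶ E} {p' : E' ⟶ X} {χ : X ⟶ B}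
    (h : IsPullback q p' p χ)
    {s : (P.pullAlong h).toRelative.sq ⟶ (P.pullAlong h).toRelative.obj}
    (hs : s ≫ (P.pullAlong h).toRelative.d = 𝟙 _) :
    ∃ ω : X ⟶ Ω.obj.obj.left, ω ≫ Ω.obj.obj.hom = χ := by
  have hd : (P.pullAlong h).d.hom.left ≫ pullback.snd χ P.sq.obj.hom =
      pullback.snd χ P.obj.obj.hom ≫ P.d.hom.left :=
    congrArg CommaMorphism.left (P.pullAlong_d h)
  -- Forgetting the base point in `X`, the section becomes a map to `P.obj` over the square of `p`;
  -- its transpose is the classifying map.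
  let m : (P.pullAlong h).sq.obj.left ⟶ P.obj.obj.left :=
    (show (P.pullAlong h).sq.obj.left ⟶ (P.pullAlong h).obj.obj.left from s) ≫
      pullback.snd χ P.obj.obj.hom
  have hm : m ≫ P.d.hom.left = pullback.snd χ P.sq.obj.hom := by
    refine (Category.assoc _ _ _).trans ((congrArg (s ≫ ·) hd.symm).trans ?_)
    exact (Category.assoc _ _ _).symm.trans ((congrArg (· ≫ _) hs).trans (Category.id_comp _))
  let ω : Over.mk χ ⟶ Ω.obj.obj := Ω.repr.homEquiv.symm
    (Over.homMk m hm : (Over.pullback P.sq.obj.hom).obj (Over.mk χ) ⟶ Over.mk P.d.hom.left)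
  exact ⟨ω.left, Over.w ω⟩

end

variable [IsPiTribe F] {E B : C} {p : E ⟶ B} {hp : F p}
  (P : PathObject (sliceFib F B) (FibrantSlice.of p hp))
  (Ω : DependentProduct P.sq (FibrantSlice.of P.d.hom.left P.fib_d))

/-- Being a proposition is a proposition. -/
lemma DependentProduct.homotopicOver {E' : C} {q : E' ⟶ E} {p' : E' ⟶ Ω.obj.obj.left}
    (h : IsPullback q p' p Ω.obj.obj.hom) {T : C} (x y : T ⟶ Ω.obj.obj.left)
    (hxy : x ≫ Ω.obj.obj.hom = y ≫ Ω.obj.obj.hom) : HomotopicOver F Ω.obj.obj.hom x y := by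
  obtain ⟨s, hs⟩ := Ω.exists_section P h
  have hd := P.pullAlong_d h
  have hsq : IsCartesian (X' := (P.pullAlong h).sq.obj) (baseChangeProj Ω.obj.obj.hom P.sq) :=
    baseChangeProj_isCartesian _ P.sq
  have hobj : IsCartesian (X' := (P.pullAlong h).obj.obj) (baseChangeProj Ω.obj.obj.hom P.obj) :=
    baseChangeProj_isCartesian _ P.obj
  -- Base change of `Ω` along its own structure map: `Ω ×_B Ω ⟶ Ω` is the dependent product of the
  -- path fibration pulled back to `Ω`, which has the section `s` and is therefore contractible.
  let W := Ω.pull (A' := (P.pullAlong h).sq)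
    (Z' := FibrantSlice.of (P.pullAlong h).d.hom.left (P.pullAlong h).fib_d) hsq
    (z := Over.homMk (baseChangeProj Ω.obj.obj.hom P.obj).left (congrArg CommaMorphism.left hd).symm)
    (hobj.isPullback_left hsq hd)
  obtain ⟨r, -, H⟩ : ∃ r : Ω.obj.obj.left ⟶ pullback Ω.obj.obj.hom Ω.obj.obj.hom,
      r ≫ pullback.fst _ _ = 𝟙 _ ∧ HomotopicOver F (pullback.fst Ω.obj.obj.hom Ω.obj.obj.hom)
        (pullback.fst _ _ ≫ r) (𝟙 _) :=
    W.exists_contraction hs ((P.pullAlong h).toRelative.homotopicOver_d_section hs)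
  -- Over their common first coordinate, `(x, x)` and `(x, y)` both contract to `x ≫ r`; the second
  -- projection turns this into a homotopy from `x` to `y` over `B`.
  have H₁ := H.precomp (pullback.lift x x rfl)
  have H₂ := H.precomp (pullback.lift x y hxy)
  rw [pullback.lift_fst_assoc, Category.comp_id] at H₁ H₂
  have H₃ := (H₁.symm.trans (MorphismProperty.pullback_fst _ _ Ω.obj.fib) H₂).postcomp Ω.obj.obj.hom
    (pullback.snd _ _) Ω.obj.obj.hom pullback.condition.symm
  rwa [pullback.lift_snd, pullback.lift_snd] at H₃

end Classifier

end Tribes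

open CategoryTheory Limits Tribes in
theorem mainTheorem7 {C : Type u} [Category.{v} C] (F : MorphismProperty C) [IsPiTribe F]
    {E B : C} (p : E ⟶ B) (hp : F p) (hu : IsUnivalent F p)
    (P : PathObject (sliceFib F B) (FibrantSlice.of p hp))
    (Ω : DependentProduct P.sq (FibrantSlice.of P.d.hom.left P.fib_d))
    {El : C} (q : El ⟶ E) (top : El ⟶ Ω.obj.obj.left)
    (hpb : IsPullback q top p Ω.obj.obj.hom) :
    IsHomotopySubobjectClassifier F (pullbackClass p hp) top := by
  obtain ⟨s, hs⟩ := Ω.exists_section P hpb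
  have htop : F top := MorphismProperty.of_isPullback hpb hp
  refine ⟨htop, (P.pullAlong hpb).toRelative.isHomotopyMono_of_section htop hs,
    hu.of_isPullback Ω.obj.fib (Ω.homotopicOver P hpb) hpb, ?_⟩
  rintro A X f ⟨q', χ, hf⟩ hm
  obtain ⟨t, ht⟩ := hm.exists_section (MorphismProperty.of_isPullback hf hp)
    (P.pullAlong hf).toRelative
  -- With `χ` factored through `Ω`, both `f` and `top` are pullbacks of `p`, and cancelling the
  -- square of `top` leaves a pullback square over `ω`.
  obtain ⟨ω, rfl⟩ := Ω.exists_classifyingMap P hf ht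
  exact ⟨_, ω, IsPullback.of_right' hf hpb⟩
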